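/- Let $M$ be a smooth manifold of dimension $n\ge 2$, let $h$ be a smooth locally projectively flat Riemannian metric on $M$ (around every point there is a local coordinate system in which all geodesics of $h$ are straight lines), and let $W$ be a smooth conformal vector field with respect to $h$, i.e. $\mathcal L_W h = 2\sigma h$ for some function $\sigma$ on $M$. If the dual 1-form $W^\flat=h(W,\cdot)$ is closed, then around every point of $M$ there is a local coordinate system $x=(x^1,\dots,x^n)$, with $1+\mu|x|^2>0$ on its domain, in which the norm of $h$ is $$\sqrt{h_x(y,y)}=\frac{\sqrt{(1+\mu|x|^2)|y|^2-\mu\langle x,y\rangle^2}}{1+\mu|x|^2}$$ and $$W=\sqrt{1+\mu|x|^2}\,(\lambda x+a),$$ where $\mu,\lambda\in\mathbb R$ are constants and $a\in\mathbb R^n$ is a constant vector. In these coordinates $$W^\flat(y)=\frac{\lambda\langle x,y\rangle+(1+\mu|x|^2)\langle a,y\rangle-\mu\langle a,x\rangle\langle x,y\rangle}{(1+\mu|x|^2)^{3/2}}.$$ Here $|\cdot|$ and $\langle\cdot,\cdot\rangle$ are the Euclidean norm and inner product on $\mathbb R^n$. -/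

import Mathlib

open Set Bundle
open scoped Manifold ContDiff

noncomputable section

/-- The model space `ℝⁿ` with the Euclidean inner product and norm. -/
abbrev Rn (n : ℕ) : Type := EuclideanSpace ℝ (Fin n)

/-- A smooth Riemannian metric on the smooth `n`-dimensional manifold `M`. -/
abbrev SmoothRiemannianMetric (n : ℕ) (M : Type*) [TopologicalSpace M] [ChartedSpace (Rn n) M]
    [IsManifold 𝓘(ℝ, Rn n) ∞ M] : Type _ :=
  ContMDiffRiemannianMetric 𝓘(ℝ, Rn n) ∞ (Rn n) (fun p : M => TangentSpace 𝓘(ℝ, Rn n) p)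

section Euclidean

variable {n : ℕ}

/-- The Christoffel symbol of the first kind of a metric `g` on an open subset of `ℝⁿ`, contracted
with constant vectors: `½ (∂_u g(v, w) + ∂_v g(u, w) - ∂_w g(u, v))` at `x`. -/
def christoffelFirst (g : Rn n → Rn n → Rn n → ℝ) (x u v w : Rn n) : ℝ :=
  (fderiv ℝ (fun z => g z v w) x u + fderiv ℝ (fun z => g z u w) x v
    - fderiv ℝ (fun z => g z u v) x w) / 2

/-- `c` restricted to the open interval `(s, t)` is a geodesic, in the open set `U ⊆ ℝⁿ`, of the
metric `g`: it stays in `U`, is twice differentiable with velocity `c'` and acceleration `c''`, and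
satisfies the geodesic equation `c''ⁱ + Γⁱⱼₖ c'ʲ c'ᵏ = 0`, written with its free index lowered by
the (nondegenerate) metric. -/
def IsGeodesicOn (g : Rn n → Rn n → Rn n → ℝ) (U : Set (Rn n)) (c : ℝ → Rn n) (s t : ℝ) : Prop :=
  ∃ c' c'' : ℝ → Rn n, ∀ τ ∈ Ioo s t, c τ ∈ U ∧ HasDerivAt c (c' τ) τ ∧
    HasDerivAt c' (c'' τ) τ ∧
    ∀ w, g (c τ) (c'' τ) w + christoffelFirst g (c τ) (c' τ) (c' τ) w = 0

/-- The Lie derivative `L_X g` of a metric on an open subset of `ℝⁿ`: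
`(L_X g)(u, v) = Xᵏ ∂ₖ g(u, v) + g(∂_u X, v) + g(u, ∂_v X)` at `x`. -/
def lieDerivMetric (g : Rn n → Rn n → Rn n → ℝ) (X : Rn n → Rn n) (x u v : Rn n) : ℝ :=
  fderiv ℝ (fun z => g z u v) x (X x) + g x (fderiv ℝ X x u) v + g x u (fderiv ℝ X x v)

end Euclidean

section Charts

variable {n : ℕ} {M : Type*} [TopologicalSpace M] [ChartedSpace (Rn n) M]
  [IsManifold 𝓘(ℝ, Rn n) ∞ M]

/-- The metric `h` in the coordinates `φ`: `metricInChart h φ x u v = hᵢⱼ(x) uⁱ vʲ` for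
`x ∈ φ.target`. -/
def metricInChart (h : SmoothRiemannianMetric n M) (φ : OpenPartialHomeomorph M (Rn n))
    (x u v : Rn n) : ℝ :=
  h.inner (φ.symm x) (mfderiv 𝓘(ℝ, Rn n) 𝓘(ℝ, Rn n) φ.symm x u)
    (mfderiv 𝓘(ℝ, Rn n) 𝓘(ℝ, Rn n) φ.symm x v)

/-- The vector field `W` in the coordinates `φ`: the components `(Wⁱ(x))ᵢ` for `x ∈ φ.target`. -/
def fieldInChart (W : ∀ p : M, TangentSpace 𝓘(ℝ, Rn n) p) (φ : OpenPartialHomeomorph M (Rn n))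
    (x : Rn n) : Rn n :=
  mfderiv 𝓘(ℝ, Rn n) 𝓘(ℝ, Rn n) φ (φ.symm x) (W (φ.symm x))

/-- The 1-form `W♭ = h(W, ·)` dual to `W`. -/
def flat (h : SmoothRiemannianMetric n M) (W : ∀ p : M, TangentSpace 𝓘(ℝ, Rn n) p) (p : M) :
    TangentSpace 𝓘(ℝ, Rn n) p →L[ℝ] ℝ :=
  h.inner p (W p)

/-- A 1-form `θ` in the coordinates `φ`: `formInChart θ φ x y = θᵢ(x) yⁱ` for `x ∈ φ.target`. -/
def formInChart (θ : ∀ p : M, TangentSpace 𝓘(ℝ, Rn n) p →L[ℝ] ℝ)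
    (φ : OpenPartialHomeomorph M (Rn n)) (x y : Rn n) : ℝ :=
  θ (φ.symm x) (mfderiv 𝓘(ℝ, Rn n) 𝓘(ℝ, Rn n) φ.symm x y)

/-- Around every point there is a smooth coordinate system in which all geodesics of `h` are
straight, i.e. the trace of each geodesic lies on a straight line. -/
def IsLocallyProjectivelyFlat (h : SmoothRiemannianMetric n M) : Prop :=
  ∀ p : M, ∃ φ ∈ IsManifold.maximalAtlas 𝓘(ℝ, Rn n) ∞ M, p ∈ φ.source ∧
    ∀ (c : ℝ → Rn n) (s t : ℝ), IsGeodesicOn (metricInChart h φ) φ.target c s t →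
      Collinear ℝ (c '' Ioo s t)

/-- `W` is a conformal vector field of `h`: `L_W h = 2 σ h` for some function `σ` on `M`. The
Lie derivative is computed in smooth coordinates. -/
def IsConformalField (h : SmoothRiemannianMetric n M) (W : ∀ p : M, TangentSpace 𝓘(ℝ, Rn n) p) :
    Prop :=
  ∃ σ : M → ℝ, ∀ φ ∈ IsManifold.maximalAtlas 𝓘(ℝ, Rn n) ∞ M, ∀ x ∈ φ.target, ∀ u v : Rn n,
    lieDerivMetric (metricInChart h φ) (fieldInChart W φ) x u v
      = 2 * σ (φ.symm x) * metricInChart h φ x u v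

/-- The (smooth) 1-form `θ` is closed: `∂_u θ(v) = ∂_v θ(u)` in all smooth coordinates. -/
def IsClosedForm (θ : ∀ p : M, TangentSpace 𝓘(ℝ, Rn n) p →L[ℝ] ℝ) : Prop :=
  ∀ φ ∈ IsManifold.maximalAtlas 𝓘(ℝ, Rn n) ∞ M, ∀ x ∈ φ.target, ∀ u v : Rn n,
    fderiv ℝ (fun z => formInChart θ φ z v) x u = fderiv ℝ (fun z => formInChart θ φ z u) x v

end Charts

end

/-! In a chart whose geodesics are straight, Γ(y, y) is proportional to y for every y. Polarization
gives Γᵏᵢⱼ = Pᵢ δᵏⱼ + Pⱼ δᵏᵢ for a smooth 1-form P, so the first derivatives of g are linear in g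
with coefficients from P (`IsMetricOn.exists_isProjectivelyFlatOn`). Equality of mixed second
derivatives, for g, forces ∂P - P ⊗ P = -μ g at each point. Applied to P, it forces dμ = 0, since n
≥ 2 leaves a direction orthogonal to any given one. This is Beltrami's theorem, `exists_curvature`.

It follows that P is closed, so there is a positive function s with ds = -s P and s(x₀) = 1. Along
rays from x₀ everything integrates explicitly: s² is a quadratic polynomial, and s⁴ g is a
polynomial determined by the values of g and P at x₀ (`scale_sq_eq`,
`scale_pow_four_mul_metric_eq`). The map x ↦ L (x - x₀) / (1 - P(x - x₀)), with P taken at x₀ and L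
an isometry from g at x₀ to the Euclidean inner product, removes P at x₀ and leaves the Klein form
of the metric.

A closed conformal field has ∇X = σ id, that is, ∂X + P ⊗ X = τ id. Dividing by s absorbs P: the
derivative of X / s is a multiple of the identity, and for n ≥ 2 such a field is affine
(`exists_field_eq`). The projective map preserves the shape "scale times affine", and in the new
coordinates the scale is √(1 + μ|X|²). The formula for W♭ is then the contraction of the two. -/

/-! ### Coordinate metrics given by pointwise bilinear forms -/

section MetricOn

variable {E : Type*} [NormedAddCommGroup E] [NormedSpace ℝ E]

/-- `g` is a smooth Riemannian metric on the subset `U` of a normed space. -/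
structure IsMetricOn (g : E → E → E → ℝ) (U : Set E) : Prop where
  smooth : ∀ u v, ContDiffOn ℝ ∞ (fun x => g x u v) U
  add_left : ∀ x ∈ U, ∀ u v w, g x (u + v) w = g x u w + g x v w
  smul_left : ∀ x ∈ U, ∀ (a : ℝ) u w, g x (a • u) w = a * g x u w
  symm : ∀ x ∈ U, ∀ u v, g x u v = g x v u
  pos : ∀ x ∈ U, ∀ u, u ≠ 0 → 0 < g x u u

namespace IsMetricOn

variable {g : E → E → E → ℝ} {U : Set E} {x : E}

theorem mono {V : Set E} (hg : IsMetricOn g U) (h : V ⊆ U) : IsMetricOn g V :=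
  ⟨fun u v => (hg.smooth u v).mono h, fun x hx => hg.add_left x (h hx),
    fun x hx => hg.smul_left x (h hx), fun x hx => hg.symm x (h hx), fun x hx => hg.pos x (h hx)⟩

theorem add_right (hg : IsMetricOn g U) (hx : x ∈ U) (u v w : E) :
    g x u (v + w) = g x u v + g x u w := by
  rw [hg.symm x hx, hg.add_left x hx, hg.symm x hx v, hg.symm x hx w]

theorem smul_right (hg : IsMetricOn g U) (hx : x ∈ U) (a : ℝ) (u w : E) :
    g x u (a • w) = a * g x u w := by
  rw [hg.symm x hx, hg.smul_left x hx, hg.symm x hx w]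

theorem zero_left (hg : IsMetricOn g U) (hx : x ∈ U) (w : E) : g x 0 w = 0 := by
  simpa using hg.smul_left x hx 0 0 w

theorem neg_left (hg : IsMetricOn g U) (hx : x ∈ U) (u w : E) : g x (-u) w = - g x u w := by
  simpa using hg.smul_left x hx (-1) u w

theorem sub_left (hg : IsMetricOn g U) (hx : x ∈ U) (u v w : E) :
    g x (u - v) w = g x u w - g x v w := by
  rw [sub_eq_add_neg, hg.add_left x hx, hg.neg_left hx, sub_eq_add_neg]

theorem eq_zero_of_forall (hg : IsMetricOn g U) (hx : x ∈ U) {u : E} (h : ∀ w, g x u w = 0) :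
    u = 0 := by
  by_contra h0
  exact (hg.pos x hx u h0).ne' (h u)

theorem contDiffAt (hg : IsMetricOn g U) (hU : IsOpen U) (hx : x ∈ U) (u v : E) :
    ContDiffAt ℝ ∞ (fun x => g x u v) x :=
  (hg.smooth u v).contDiffAt (hU.mem_nhds hx)

theorem hasFDerivAt (hg : IsMetricOn g U) (hU : IsOpen U) (hx : x ∈ U) (u v : E) :
    HasFDerivAt (fun x => g x u v) (fderiv ℝ (fun x => g x u v) x) x :=
  ((hg.contDiffAt hU hx u v).differentiableAt (by simp)).hasFDerivAt

theorem fderiv_symm (hg : IsMetricOn g U) (hU : IsOpen U) (hx : x ∈ U) (u v : E) :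
    fderiv ℝ (fun x => g x u v) x = fderiv ℝ (fun x => g x v u) x := by
  apply Filter.EventuallyEq.fderiv_eq
  filter_upwards [hU.mem_nhds hx] with z hz using hg.symm z hz u v

theorem fderiv_add_left (hg : IsMetricOn g U) (hU : IsOpen U) (hx : x ∈ U) (u v w : E) :
    fderiv ℝ (fun x => g x (u + v) w) x =
      fderiv ℝ (fun x => g x u w) x + fderiv ℝ (fun x => g x v w) x := by
  refine (((hg.hasFDerivAt hU hx u w).add (hg.hasFDerivAt hU hx v w)).congr_of_eventuallyEq
    ?_).fderiv
  filter_upwards [hU.mem_nhds hx] with z hz using hg.add_left z hz u v w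

theorem fderiv_smul_left (hg : IsMetricOn g U) (hU : IsOpen U) (hx : x ∈ U) (a : ℝ) (u w : E) :
    fderiv ℝ (fun x => g x (a • u) w) x = a • fderiv ℝ (fun x => g x u w) x := by
  refine (((hg.hasFDerivAt hU hx u w).const_mul a).congr_of_eventuallyEq ?_).fderiv
  filter_upwards [hU.mem_nhds hx] with z hz using hg.smul_left z hz a u w

end IsMetricOn
end MetricOn

/-! ### Geodesics and the spray of a metric with straight geodesics -/

section Geodesics

variable {n : ℕ} {g : Rn n → Rn n → Rn n → ℝ} {U : Set (Rn n)} {x : Rn n}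

/-- The operator representing the bilinear form `B` in the Euclidean inner product. -/
theorem exists_operator_of_bilinear {B : Rn n → Rn n → ℝ}
    (hadd : ∀ u v w, B (u + v) w = B u w + B v w) (hsmul : ∀ (a : ℝ) u w, B (a • u) w = a * B u w)
    (hadd' : ∀ u v w, B u (v + w) = B u v + B u w)
    (hsmul' : ∀ (a : ℝ) u w, B u (a • w) = a * B u w) :
    ∃ A : Rn n →L[ℝ] Rn n, ∀ u w, inner ℝ (A u) w = B u w := by
  let L : Rn n →ₗ[ℝ] Rn n →ₗ[ℝ] ℝ := LinearMap.mk₂ ℝ B hadd (by simpa using hsmul) hadd'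
    (by simpa using hsmul')
  let e : (Rn n →ₗ[ℝ] ℝ) ≃ₗ[ℝ] Rn n :=
    (LinearMap.toContinuousLinearMap (𝕜 := ℝ) (E := Rn n) (F' := ℝ)).trans
      (InnerProductSpace.toDual ℝ (Rn n)).symm.toLinearEquiv
  refine ⟨LinearMap.toContinuousLinearMap (e.toLinearMap ∘ₗ L), fun u w => ?_⟩
  have : inner ℝ ((InnerProductSpace.toDual ℝ (Rn n)).symm
      (LinearMap.toContinuousLinearMap (L u))) w = L u w := by
    rw [InnerProductSpace.toDual_symm_apply]; rfl
  exact this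

theorem contDiffOn_of_inner {F : Type*} [NormedAddCommGroup F] [NormedSpace ℝ F]
    {f : F → Rn n} {s : Set F} {k : ℕ∞ω} (h : ∀ w, ContDiffOn ℝ k (fun x => inner ℝ (f x) w) s) :
    ContDiffOn ℝ k f s := by
  rw [contDiffOn_piLp]
  intro i
  refine (h (EuclideanSpace.single i 1)).congr fun x _ => ?_
  simp [EuclideanSpace.inner_single_right]

/-- Local existence of geodesics with given initial velocity. -/
theorem exists_isGeodesicOn (hg : IsMetricOn g U) (hU : IsOpen U) (hx : x ∈ U) (y : Rn n) :
    ∃ ε > 0, ∃ c c' c'' : ℝ → Rn n, c 0 = x ∧ c' 0 = y ∧ ∀ τ ∈ Ioo (-ε) ε, c τ ∈ U ∧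
      HasDerivAt c (c' τ) τ ∧ HasDerivAt c' (c'' τ) τ ∧
      ∀ w, g (c τ) (c'' τ) w + christoffelFirst g (c τ) (c' τ) (c' τ) w = 0 := by
  have hop : ∀ z, ∃ A : Rn n →L[ℝ] Rn n, z ∈ U → ∀ u w, inner ℝ (A u) w = g z u w := by
    intro z
    by_cases hz : z ∈ U
    · obtain ⟨A, hA⟩ := exists_operator_of_bilinear (B := g z) (hg.add_left z hz)
        (hg.smul_left z hz) (fun u v w => hg.add_right hz u v w)
        (fun a u w => hg.smul_right hz a u w)
      exact ⟨A, fun _ => hA⟩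
    · exact ⟨0, fun h => absurd h hz⟩
  choose A hA using hop
  have hAsmooth : ContDiffOn ℝ ∞ A U := by
    rw [contDiffOn_clm_apply]
    intro u
    refine contDiffOn_of_inner fun w => (hg.smooth u w).congr fun z hz => hA z hz u w
  have hAx : ContDiffAt ℝ ∞ A x := hAsmooth.contDiffAt (hU.mem_nhds hx)
  have hAd : ∀ z ∈ U, ∀ u v w, fderiv ℝ (fun z => g z u v) z w = inner ℝ (fderiv ℝ A z w u) v := by
    intro z hz u v w
    have h1 : HasFDerivAt A (fderiv ℝ A z) z :=
      ((hAsmooth.contDiffAt (hU.mem_nhds hz)).differentiableAt (by simp)).hasFDerivAt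
    have h2 := (h1.clm_apply (hasFDerivAt_const u z)).inner ℝ (hasFDerivAt_const v z)
    have h3 : HasFDerivAt (fun z => g z u v) _ z := h2.congr_of_eventuallyEq (by
      filter_upwards [hU.mem_nhds hz] with z' hz' using (hA z' hz' u v).symm)
    rw [h3.fderiv]
    simp
  have hinvA : ∀ z ∈ U, (A z).IsInvertible := by
    intro z hz
    have hinj : Function.Injective (A z : Rn n →ₗ[ℝ] Rn n) := by
      rw [injective_iff_map_eq_zero]
      intro u hu
      refine hg.eq_zero_of_forall hz fun w => ?_
      have h2 : A z u = 0 := hu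
      rw [← hA z hz, h2, inner_zero_left]
    exact ⟨(LinearEquiv.ofInjectiveEndo _ hinj).toContinuousLinearEquiv, by ext; rfl⟩
  -- `K (x, y)` is the Euclidean vector representing w ↦ ∂_y g(y, w) - ½ ∂_w g(y, y), the
  -- Christoffel form on (y, y). Defining it by components makes its regularity immediate.
  let K : Rn n × Rn n → Rn n := fun p => WithLp.toLp 2 fun i =>
    inner ℝ (fderiv ℝ A p.1 p.2 p.2) (EuclideanSpace.single i (1 : ℝ)) -
      (1 / 2 : ℝ) * inner ℝ (fderiv ℝ A p.1 (EuclideanSpace.single i (1 : ℝ)) p.2) p.2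
  have hKw : ∀ p w, inner ℝ (K p) w =
      inner ℝ (fderiv ℝ A p.1 p.2 p.2) w - (1 / 2 : ℝ) * inner ℝ (fderiv ℝ A p.1 w p.2) p.2 := by
    intro p w
    have hw : w = ∑ i, w i • EuclideanSpace.single i (1 : ℝ) := by
      ext j
      simp [Finset.sum_apply, Pi.single_apply]
    have hlin : ∀ B : Rn n →ₗ[ℝ] ℝ, B w = ∑ i, w i * B (EuclideanSpace.single i (1 : ℝ)) := by
      intro B
      conv_lhs => rw [hw]
      simp
    let B : Rn n →ₗ[ℝ] ℝ :=
      { toFun := fun w => inner ℝ (fderiv ℝ A p.1 p.2 p.2) w -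
          (1 / 2 : ℝ) * inner ℝ (fderiv ℝ A p.1 w p.2) p.2
        map_add' := fun a b => by simp [inner_add_right, inner_add_left]; ring
        map_smul' := fun a b => by simp [inner_smul_right, inner_smul_left]; ring }
    change _ = B w
    rw [hlin B]
    simp [K, B, PiLp.inner_apply]
  -- The geodesic equation as a first-order system in position and velocity. It is C¹ near (x, y),
  -- so Picard–Lindelöf applies.
  let f : Rn n × Rn n → Rn n × Rn n := fun p =>
    (p.2, - (ContinuousLinearMap.inverse (A p.1)) (K p))
  have hA' : ContDiffAt ℝ 1 (fderiv ℝ A) x := hAx.fderiv_right (m := 1) (by norm_cast)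
  have hA1 : ContDiffAt ℝ 1 (fun p : Rn n × Rn n => fderiv ℝ A p.1) (x, y) :=
    ContDiffAt.comp (x, y) (f := Prod.fst) hA' contDiffAt_fst
  have hK : ContDiffAt ℝ 1 K (x, y) := by
    rw [contDiffAt_piLp]
    intro i
    refine ContDiffAt.sub
      (((hA1.clm_apply contDiffAt_snd).clm_apply contDiffAt_snd).inner ℝ contDiffAt_const)
      (contDiffAt_const.mul
        (((hA1.clm_apply contDiffAt_const).clm_apply contDiffAt_snd).inner ℝ contDiffAt_snd))
  have hinv : ContDiffAt ℝ 1 (fun p : Rn n × Rn n => ContinuousLinearMap.inverse (A p.1))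
      (x, y) := by
    have h1 : ContDiffAt ℝ 1 (fun p : Rn n × Rn n => A p.1) (x, y) :=
      ContDiffAt.comp (x, y) (f := Prod.fst) (hAx.of_le (by exact_mod_cast le_top)) contDiffAt_fst
    exact ContDiffAt.comp (x, y) (hinvA x hx).contDiffAt_map_inverse h1
  have hf : ContDiffAt ℝ 1 f (x, y) := contDiffAt_snd.prodMk (hinv.clm_apply hK).neg
  obtain ⟨α, hα0, ε, hε, hα⟩ :=
    hf.exists_forall_mem_closedBall_exists_eq_forall_mem_Ioo_hasDerivAt₀ 0
  have hcont : ContinuousAt (fun t => (α t).1) 0 :=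
    (hα 0 (by simp [hε])).continuousAt.fst
  have hmem : ∀ᶠ t in nhds (0 : ℝ), (α t).1 ∈ U :=
    hcont.eventually_mem (by rw [hα0]; exact hU.mem_nhds hx)
  obtain ⟨δ, hδ, hball⟩ := Metric.eventually_nhds_iff.1 hmem
  refine ⟨min ε δ, lt_min hε hδ, fun t => (α t).1, fun t => (α t).2, fun t => (f (α t)).2,
    by simp [hα0], by simp [hα0], ?_⟩
  intro τ hτ
  have hτε : τ ∈ Ioo (0 - ε) (0 + ε) := by
    constructor <;> [have := hτ.1; have := hτ.2] <;> have := min_le_left ε δ <;> linarith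
  have hτU : (α τ).1 ∈ U := by
    apply hball
    rw [Real.dist_eq, sub_zero, abs_lt]
    constructor <;> [have := hτ.1; have := hτ.2] <;> have := min_le_right ε δ <;> linarith
  have hd := hα τ hτε
  refine ⟨hτU, hd.fst, hd.snd, fun w => ?_⟩
  obtain ⟨e, he⟩ := hinvA _ hτU
  have h1 : A (α τ).1 (f (α τ)).2 = - K (α τ) := by
    simp only [f, ← he, ContinuousLinearMap.inverse_equiv, map_neg]
    simp
  rw [← hA _ hτU, h1, inner_neg_left, hKw]
  simp only [christoffelFirst, hAd _ hτU]
  ring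

/-- Pairing the curve with any w orthogonal to the line's direction v gives a constant, so velocity
and acceleration are both orthogonal to v^⊥ and lie in the span of v. Nonzero velocity then allows
division. -/
theorem exists_smul_of_collinear {c c' c'' : ℝ → Rn n} {ε : ℝ} (hε : 0 < ε)
    (hc : ∀ τ ∈ Ioo (-ε) ε, HasDerivAt c (c' τ) τ)
    (hc' : HasDerivAt c' (c'' 0) 0) (h0 : c' 0 ≠ 0)
    (hcol : Collinear ℝ (c '' Ioo (-ε) ε)) : ∃ κ : ℝ, c'' 0 = κ • c' 0 := by
  have h00 : (0 : ℝ) ∈ Ioo (-ε) ε := by simp [hε]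
  obtain ⟨v, hv⟩ := (collinear_iff_of_mem (mem_image_of_mem c h00)).1 hcol
  have key : ∀ w : Rn n, inner ℝ w v = 0 → inner ℝ w (c' 0) = 0 ∧ inner ℝ w (c'' 0) = 0 := by
    intro w hw
    have h1 : ∀ τ ∈ Ioo (-ε) ε, inner ℝ w (c τ) = inner ℝ w (c 0) := by
      intro τ hτ
      obtain ⟨r, hr⟩ := hv _ (mem_image_of_mem c hτ)
      rw [hr]
      simp [inner_add_right, inner_smul_right, hw]
    have h2 : ∀ τ ∈ Ioo (-ε) ε, inner ℝ w (c' τ) = 0 := by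
      intro τ hτ
      have hd : HasDerivAt (fun t => inner ℝ w (c t)) (inner ℝ w (c' τ)) τ := by
        simpa using (hasDerivAt_const τ w).inner ℝ (hc τ hτ)
      have hd' : HasDerivAt (fun t => inner ℝ w (c t)) 0 τ := by
        refine (hasDerivAt_const τ (inner ℝ w (c 0))).congr_of_eventuallyEq ?_
        filter_upwards [isOpen_Ioo.mem_nhds hτ] with t ht using h1 t ht
      exact hd.unique hd'
    refine ⟨h2 0 h00, ?_⟩
    have hd : HasDerivAt (fun t => inner ℝ w (c' t)) (inner ℝ w (c'' 0)) 0 := by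
      simpa using (hasDerivAt_const 0 w).inner ℝ hc'
    have hd' : HasDerivAt (fun t => inner ℝ w (c' t)) 0 0 := by
      refine (hasDerivAt_const (0 : ℝ) (0 : ℝ)).congr_of_eventuallyEq ?_
      filter_upwards [isOpen_Ioo.mem_nhds h00] with t ht using h2 t ht
    exact hd.unique hd'
  have hspan : ∀ y : Rn n, (∀ w : Rn n, inner ℝ w v = 0 → inner ℝ w y = 0) →
      ∃ a : ℝ, y = a • v := by
    intro y hy
    have : y ∈ (ℝ ∙ v)ᗮᗮ := by
      rw [Submodule.mem_orthogonal]
      intro u hu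
      exact hy u (by rw [real_inner_comm]; exact Submodule.mem_orthogonal_singleton_iff_inner_right.1 hu)
    rw [Submodule.orthogonal_orthogonal, Submodule.mem_span_singleton] at this
    obtain ⟨a, ha⟩ := this
    exact ⟨a, ha.symm⟩
  obtain ⟨a, ha⟩ := hspan _ fun w hw => (key w hw).1
  obtain ⟨b, hb⟩ := hspan _ fun w hw => (key w hw).2
  have ha0 : a ≠ 0 := by
    rintro rfl
    exact h0 (by simpa using ha)
  refine ⟨b / a, ?_⟩
  rw [ha, hb, smul_smul, div_mul_cancel₀ _ ha0]

/-- If all geodesics are straight, the geodesic spray is proportional to the velocity. -/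
theorem christoffelFirst_self_of_straight (hg : IsMetricOn g U) (hU : IsOpen U)
    (hstraight : ∀ (c : ℝ → Rn n) (s t : ℝ), IsGeodesicOn g U c s t → Collinear ℝ (c '' Ioo s t))
    (hx : x ∈ U) (y : Rn n) : ∃ κ : ℝ, ∀ w, christoffelFirst g x y y w = κ * g x y w := by
  rcases eq_or_ne y 0 with rfl | hy
  · refine ⟨0, fun w => ?_⟩
    have h1 : fderiv ℝ (fun z => g z 0 0) x = 0 := by
      simpa using hg.fderiv_smul_left hU hx 0 0 0
    simp [christoffelFirst, h1]
  obtain ⟨ε, hε, c, c', c'', h0, h0', h⟩ := exists_isGeodesicOn hg hU hx y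
  have h00 : (0 : ℝ) ∈ Ioo (-ε) ε := by simp [hε]
  obtain ⟨κ, hκ⟩ := exists_smul_of_collinear hε (fun τ hτ => (h τ hτ).2.1) (h 0 h00).2.2.1
    (by rwa [h0']) (hstraight c _ _ ⟨c', c'', h⟩)
  refine ⟨-κ, fun w => ?_⟩
  have := (h 0 h00).2.2.2 w
  rw [hκ, h0, h0', hg.smul_left x hx] at this
  linarith

end Geodesics

/-! ### The 1-form P governing the Christoffel symbols -/

section ProjectiveForm

variable {n : ℕ} {g : Rn n → Rn n → Rn n → ℝ} {U : Set (Rn n)} {x : Rn n}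

/-- If `Γ(y, y)` is proportional to `y` for all `y`, the factor of proportionality is linear in `y`,
and the derivative of the metric is expressed through it. -/
theorem IsMetricOn.exists_projective_form_at (hg : IsMetricOn g U) (hU : IsOpen U) (hx : x ∈ U)
    (h : ∀ y, ∃ κ : ℝ, ∀ w, christoffelFirst g x y y w = κ * g x y w) :
    ∃ p : Rn n →L[ℝ] ℝ,
      (∀ u, p u = fderiv ℝ (fun z => g z u u) x u / (4 * g x u u)) ∧
      ∀ u v w, fderiv ℝ (fun z => g z u v) x w =
        2 * p w * g x u v + p u * g x w v + p v * g x w u := by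
  set D : Rn n → Rn n → Rn n → ℝ := fun u v w => fderiv ℝ (fun z => g z u v) x w with hD
  have Dadd1 : ∀ u u' v w, D (u + u') v w = D u v w + D u' v w := fun u u' v w => by
    simp [hD, hg.fderiv_add_left hU hx]
  have Dsmul1 : ∀ (a : ℝ) u v w, D (a • u) v w = a * D u v w := fun a u v w => by
    simp [hD, hg.fderiv_smul_left hU hx]
  have Dsymm : ∀ u v w, D u v w = D v u w := fun u v w => by
    simp [hD, hg.fderiv_symm hU hx u v]
  have Dadd2 : ∀ u v v' w, D u (v + v') w = D u v w + D u v' w := fun u v v' w => by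
    rw [Dsymm, Dadd1, Dsymm v, Dsymm v']
  have Dsmul2 : ∀ (a : ℝ) u v w, D u (a • v) w = a * D u v w := fun a u v w => by
    rw [Dsymm, Dsmul1, Dsymm v]
  have Dadd3 : ∀ u v w w', D u v (w + w') = D u v w + D u v w' := fun u v w w' => by simp [hD]
  have Dsmul3 : ∀ (a : ℝ) u v w, D u v (a • w) = a * D u v w := fun a u v w => by simp [hD]
  -- Forced by contracting Γ(y, y) = 2 p(y) y with y itself. At u = 0 division by zero gives the
  -- correct value 0.
  set p : Rn n → ℝ := fun u => D u u u / (4 * g x u u) with hp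
  have hdiag : ∀ y w, D y w y - D y y w / 2 = 2 * p y * g x y w := by
    intro y w
    rcases eq_or_ne y 0 with rfl | hy
    · have h1 := Dsmul1 0 0 w 0
      have h2 := Dsmul1 0 0 0 w
      simp only [zero_smul, zero_mul] at h1 h2
      rw [h1, h2, hg.zero_left hx]; simp
    · obtain ⟨κ, hκ⟩ := h y
      have hpos := hg.pos x hx y hy
      have h1 : D y y y / 2 = κ * g x y y := by
        rw [← hκ y]; simp only [christoffelFirst, hD]; ring
      have h2 : D y w y - D y y w / 2 = κ * g x y w := by
        rw [← hκ w]; simp only [christoffelFirst, hD]; ring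
      have h3 : κ = 2 * p y := by
        simp only [hp]
        field_simp
        linarith
      rw [h2, h3]
  have phom : ∀ (a : ℝ) u, p (a • u) = a * p u := by
    intro a u
    simp only [hp, Dsmul1, Dsmul2, Dsmul3, hg.smul_left x hx, hg.smul_right hx]
    rcases eq_or_ne a 0 with rfl | ha
    · simp
    rcases eq_or_ne (g x u u) 0 with h0 | h0
    · simp [h0]
    · field_simp
  have padd : ∀ u v, p (u + v) = p u + p v := by
    intro u v
    rcases eq_or_ne u 0 with rfl | hu
    · have := phom 0 0
      simp only [zero_smul, zero_mul] at this
      simp [this]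
    by_cases hdep : ∃ a : ℝ, a • u = v
    · obtain ⟨a, rfl⟩ := hdep
      have h1 : u + a • u = (1 + a) • u := by rw [add_smul, one_smul]
      rw [h1, phom, phom]; ring
    -- The parallelogram law for the quadratic map Γ(y, y) gives p(u+v)(u+v) + p(u-v)(u-v) = 2p(u)u
    -- + 2p(v)v. Comparing coefficients of u and v and adding yields additivity.
    · have hli : LinearIndependent ℝ ![u, v] :=
        (LinearIndependent.pair_iff' hu).2 fun a ha => hdep ⟨a, ha⟩
      have hvec : (p (u + v) + p (u + (-1 : ℝ) • v) - 2 * p u) • u +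
          (p (u + v) - p (u + (-1 : ℝ) • v) - 2 * p v) • v = 0 := by
        refine hg.eq_zero_of_forall hx fun w => ?_
        have h1 := hdiag (u + v) w
        have h2 := hdiag (u + (-1 : ℝ) • v) w
        have h3 := hdiag u w
        have h4 := hdiag v w
        simp only [Dadd1, Dadd2, Dadd3, Dsmul1, Dsmul2, Dsmul3, hg.add_left x hx,
          hg.smul_left x hx] at h1 h2 h3 h4 ⊢
        linarith
      have := LinearIndependent.pair_iff.1 hli _ _ hvec
      linarith [this.1, this.2]
  have hB : ∀ u v w, (D v w u + D u w v - D u v w) / 2 = p u * g x v w + p v * g x u w := by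
    intro u v w
    have h1 := hdiag (u + v) w
    have h3 := hdiag u w
    have h4 := hdiag v w
    have h5 := Dsymm u v w
    simp only [Dadd1, Dadd2, Dadd3, hg.add_left x hx, padd] at h1 h3 h4
    linarith
  refine ⟨LinearMap.toContinuousLinearMap
    { toFun := p, map_add' := padd, map_smul' := by simpa using phom }, fun u => rfl, ?_⟩
  intro u v w
  change D u v w = 2 * p w * g x u v + p u * g x w v + p v * g x w u
  -- Metric compatibility: ∂_w g(u, v) is the sum of the Christoffel forms Γ(w, u; v) and Γ(w, v;
  -- u).
  have h1 := hB w u v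
  have h2 := hB w v u
  rw [hg.symm x hx v u] at h2
  have h3 := Dsymm v u w
  have h4 := Dsymm u w v
  have h5 := Dsymm v w u
  have h6 := Dsymm w v u
  linarith

end ProjectiveForm

/-! ### Curvature and Beltrami's theorem -/

section ProjectivelyFlat

variable {E : Type*} [NormedAddCommGroup E] [NormedSpace ℝ E]

/-- The metric `g` on `U` has Christoffel symbols `Γᵏᵢⱼ = Pᵢ δᵏⱼ + Pⱼ δᵏᵢ`. -/
structure IsProjectivelyFlatOn (g : E → E → E → ℝ) (P : E → E →L[ℝ] ℝ) (U : Set E) : Prop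
    extends IsMetricOn g U where
  smooth_form : ContDiffOn ℝ ∞ P U
  fderiv_eq : ∀ x ∈ U, ∀ u v w, fderiv ℝ (fun z => g z u v) x w =
    2 * P x w * g x u v + P x u * g x w v + P x v * g x w u

theorem IsProjectivelyFlatOn.mono {g : E → E → E → ℝ} {P : E → E →L[ℝ] ℝ} {U V : Set E}
    (hg : IsProjectivelyFlatOn g P U) (h : V ⊆ U) : IsProjectivelyFlatOn g P V :=
  ⟨hg.toIsMetricOn.mono h, hg.smooth_form.mono h, fun x hx => hg.fderiv_eq x (h hx)⟩

/-- P is chosen point by point. Its smoothness comes from the closed formula P(u) = ∂_u g(u, u) / (4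
g(u, u)) for each fixed u ≠ 0. -/
theorem IsMetricOn.exists_isProjectivelyFlatOn {n : ℕ} {g : Rn n → Rn n → Rn n → ℝ}
    {U : Set (Rn n)} (hg : IsMetricOn g U) (hU : IsOpen U)
    (hstraight : ∀ (c : ℝ → Rn n) (s t : ℝ), IsGeodesicOn g U c s t →
      Collinear ℝ (c '' Ioo s t)) :
    ∃ P, IsProjectivelyFlatOn g P U := by
  have h : ∀ x, ∃ p : Rn n →L[ℝ] ℝ, x ∈ U →
      (∀ u, p u = fderiv ℝ (fun z => g z u u) x u / (4 * g x u u)) ∧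
      ∀ u v w, fderiv ℝ (fun z => g z u v) x w =
        2 * p w * g x u v + p u * g x w v + p v * g x w u := by
    intro x
    by_cases hx : x ∈ U
    · obtain ⟨p, hp⟩ := hg.exists_projective_form_at hU hx
        (christoffelFirst_self_of_straight hg hU hstraight hx)
      exact ⟨p, fun _ => hp⟩
    · exact ⟨0, fun h => absurd h hx⟩
  choose P hP using h
  refine ⟨P, hg, ?_, fun x hx => (hP x hx).2⟩
  rw [contDiffOn_clm_apply]
  intro u
  rcases eq_or_ne u 0 with rfl | hu
  · simpa using contDiffOn_const
  have h1 : ContDiffOn ℝ ∞ (fun x => fderiv ℝ (fun z => g z u u) x u / (4 * g x u u)) U := by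
    refine ContDiffOn.div ?_ (contDiffOn_const.mul (hg.smooth u u)) fun x hx => ?_
    · exact ((hg.smooth u u).fderiv_of_isOpen hU (m := ∞) (by norm_cast)).clm_apply
        contDiffOn_const
    · exact mul_ne_zero four_ne_zero (hg.pos x hx u hu).ne'
  exact h1.congr fun x hx => (hP x hx).1 u

/-- Mixed second derivatives commute, for a gradient given by explicit expressions. -/
theorem fderiv_comm_of_fderiv_eq {F : Type*} [NormedAddCommGroup F] [NormedSpace ℝ F]
    {f : E → F} {D : E → E → F} {U : Set E} (hU : IsOpen U)
    (hf : ContDiffOn ℝ ∞ f U) (hD : ∀ y ∈ U, ∀ w, fderiv ℝ f y w = D w y) {x : E} (hx : x ∈ U)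
    (z w : E) : fderiv ℝ (D w) x z = fderiv ℝ (D z) x w := by
  have hfx : ContDiffAt ℝ ∞ f x := hf.contDiffAt (hU.mem_nhds hx)
  have hsymm : IsSymmSndFDerivAt ℝ f x := hfx.isSymmSndFDerivAt (by simp; norm_cast)
  have hd : DifferentiableAt ℝ (fderiv ℝ f) x :=
    (hfx.fderiv_right (m := 1) (by norm_cast)).differentiableAt one_ne_zero
  have key : ∀ w z, fderiv ℝ (D w) x z = fderiv ℝ (fderiv ℝ f) x z w := by
    intro w z
    have h1 := hd.hasFDerivAt.clm_apply (hasFDerivAt_const w x)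
    have h2 : HasFDerivAt (D w) _ x := h1.congr_of_eventuallyEq (by
      filter_upwards [hU.mem_nhds hx] with y hy using (hD y hy w).symm)
    rw [h2.fderiv]; simp
  rw [key, key, hsymm]

/-- The pointwise algebra behind Beltrami's theorem. -/
theorem eq_smul_of_curvature_identity {g Q : E →ₗ[ℝ] E →ₗ[ℝ] ℝ} (hsymm : ∀ u v, g u v = g v u)
    (hpos : ∀ u, u ≠ 0 → 0 < g u u)
    (h : ∀ u v z w, 2 * (Q z w - Q w z) * g u v + Q z u * g w v - Q w u * g z v
      + Q z v * g w u - Q w v * g z u = 0) :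
    ∃ μ : ℝ, ∀ z w, Q z w = -μ * g z w := by
  -- For z ⟂ w, the identity at (z, z, z, w) and (w, w, w, z) gives Q(z, w) = 2 Q(w, z) and Q(w, z)
  -- = 2 Q(z, w).
  have horth : ∀ z w, g z w = 0 → Q z w = 0 := by
    intro z w hzw
    rcases eq_or_ne z 0 with rfl | hz
    · simp
    rcases eq_or_ne w 0 with rfl | hw
    · simp
    have hwz : g w z = 0 := by rw [hsymm, hzw]
    have h1 := h z z z w
    have h2 := h w w w z
    rw [hwz] at h1
    rw [hzw] at h2
    have h3 : (Q z w - 2 * Q w z) * g z z = 0 := by linarith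
    have h4 : (Q w z - 2 * Q z w) * g w w = 0 := by linarith
    have h5 := (mul_eq_zero.1 h3).resolve_right (hpos z hz).ne'
    have h6 := (mul_eq_zero.1 h4).resolve_right (hpos w hw).ne'
    linarith
  have horth' : ∀ z w, g z w = 0 → Q z z * g w w = Q w w * g z z := by
    intro z w hzw
    have h1 := h z w z w
    rw [hsymm w z, hzw] at h1
    linarith
  have hexp : ∀ a b, a ≠ 0 → Q a b = Q a a / g a a * g a b := by
    intro a b ha
    have hga := (hpos a ha).ne'
    have h1 := horth a (b - (g a b / g a a) • a) (by
      simp only [map_sub, map_smul, smul_eq_mul]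
      field_simp
      ring)
    simp only [map_sub, map_smul, smul_eq_mul] at h1
    field_simp at h1 ⊢
    linarith
  have hexp' : ∀ a b, a ≠ 0 → Q b a = Q a a / g a a * g a b := by
    intro a b ha
    have hga := (hpos a ha).ne'
    have h1 := horth (b - (g a b / g a a) • a) a (by
      rw [hsymm]
      simp only [map_sub, map_smul, smul_eq_mul]
      field_simp
      ring)
    simp only [map_sub, map_smul, smul_eq_mul, LinearMap.sub_apply, LinearMap.smul_apply] at h1
    field_simp at h1 ⊢
    linarith
  by_cases hE : ∃ e : E, e ≠ 0
  · obtain ⟨e, he⟩ := hE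
    have hge := (hpos e he).ne'
    refine ⟨-(Q e e / g e e), fun z w => ?_⟩
    rcases eq_or_ne z 0 with rfl | hz
    · simp
    have hgz := (hpos z hz).ne'
    -- If e ⟂ z, the ratios agree by `horth'`. Otherwise Q(e, z) is computed by projecting along e
    -- and along z, and g(e, z) cancels.
    have hratio : Q z z / g z z = Q e e / g e e := by
      by_cases hez : g e z = 0
      · have := horth' e z hez
        field_simp
        linarith
      · have h1 := hexp e z he
        have h2 := hexp' z e hz
        rw [h1, hsymm z e] at h2
        exact (mul_right_cancel₀ hez h2).symm
    rw [hexp z w hz, hratio]; ring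
  · push Not at hE
    exact ⟨0, fun z w => by simp [hE z]⟩

namespace IsProjectivelyFlatOn

variable {g : E → E → E → ℝ} {P : E → E →L[ℝ] ℝ} {U : Set E} {x : E}

theorem hasFDerivAt_form (hg : IsProjectivelyFlatOn g P U) (hU : IsOpen U) (hx : x ∈ U) (w : E) :
    HasFDerivAt (fun y => P y w) ((fderiv ℝ P x).flip w) x := by
  have h1 : HasFDerivAt P (fderiv ℝ P x) x :=
    ((hg.smooth_form.contDiffAt (hU.mem_nhds hx)).differentiableAt (by simp)).hasFDerivAt
  exact (h1.clm_apply (hasFDerivAt_const w x)).congr_fderiv (by ext z; simp)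

/-- A projectively flat metric satisfies `∇P - P ⊗ P = -μ g` pointwise. -/
theorem exists_curvature_at (hg : IsProjectivelyFlatOn g P U) (hU : IsOpen U) (hx : x ∈ U) :
    ∃ μ : ℝ, ∀ z w, fderiv ℝ P x z w = P x z * P x w - μ * g x z w := by
  let gx : E →ₗ[ℝ] E →ₗ[ℝ] ℝ := LinearMap.mk₂ ℝ (g x) (hg.add_left x hx)
    (by simpa using hg.smul_left x hx) (fun u v w => hg.add_right hx u v w)
    (by simpa using fun a u w => hg.smul_right hx a u w)
  let Q : E →ₗ[ℝ] E →ₗ[ℝ] ℝ := LinearMap.mk₂ ℝ (fun z w => fderiv ℝ P x z w - P x z * P x w)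
    (fun u v w => by simp; ring) (fun a u v => by simp; ring) (fun u v w => by simp; ring)
    (fun a u v => by simp; ring)
  -- Commuting second derivatives of g(u, v). After the derivatives of g are substituted, P survives
  -- only through Q = ∂P - P ⊗ P.
  have hid : ∀ u v z w, 2 * (Q z w - Q w z) * gx u v + Q z u * gx w v - Q w u * gx z v
      + Q z v * gx w u - Q w v * gx z u = 0 := by
    intro u v z w
    have h := fderiv_comm_of_fderiv_eq hU (hg.smooth u v)
      (fun y hy w => hg.fderiv_eq y hy u v w) hx z w
    have hd : ∀ w, HasFDerivAt (fun y => 2 * P y w * g y u v + P y u * g y w v + P y v * g y w u)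
        _ x := fun w =>
      ((((hg.hasFDerivAt_form hU hx w).const_mul 2).mul (hg.hasFDerivAt hU hx u v)).add
        ((hg.hasFDerivAt_form hU hx u).mul (hg.hasFDerivAt hU hx w v))).add
        ((hg.hasFDerivAt_form hU hx v).mul (hg.hasFDerivAt hU hx w u))
    rw [(hd w).fderiv, (hd z).fderiv] at h
    simp only [add_apply, smul_apply,
      ContinuousLinearMap.flip_apply, smul_eq_mul, hg.fderiv_eq x hx] at h
    simp only [Q, gx, LinearMap.mk₂_apply]
    rw [hg.symm x hx z w] at h
    linear_combination h
  obtain ⟨μ, hμ⟩ := eq_smul_of_curvature_identity (g := gx) (Q := Q)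
    (fun u v => hg.symm x hx u v) (fun u hu => hg.pos x hx u hu) hid
  refine ⟨μ, fun z w => ?_⟩
  have := hμ z w
  simp only [Q, gx, LinearMap.mk₂_apply] at this
  linarith

/-- **Beltrami's theorem**: the curvature of a projectively flat metric is constant. -/
theorem exists_curvature [FiniteDimensional ℝ E] (hdim : 1 < Module.finrank ℝ E)
    (hg : IsProjectivelyFlatOn g P U)
    (hU : IsOpen U) (hconn : IsPreconnected U) :
    ∃ μ : ℝ, ∀ x ∈ U, ∀ z w, fderiv ℝ P x z w = P x z * P x w - μ * g x z w := by
  have h : ∀ x, ∃ μ : ℝ, x ∈ U → ∀ z w, fderiv ℝ P x z w = P x z * P x w - μ * g x z w := by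
    intro x
    by_cases hx : x ∈ U
    · obtain ⟨μ, hμ⟩ := hg.exists_curvature_at hU hx
      exact ⟨μ, fun _ => hμ⟩
    · exact ⟨0, fun h => absurd h hx⟩
  choose μ hμ using h
  have : Nontrivial E := Module.nontrivial_of_finrank_pos (R := ℝ) (by omega)
  obtain ⟨e, he⟩ := exists_ne (0 : E)
  -- μ was chosen pointwise. Solving the curvature equation on the diagonal at a fixed e ≠ 0
  -- exhibits it as a smooth quotient.
  have hμsmooth : ContDiffOn ℝ ∞ μ U := by
    have h1 : ContDiffOn ℝ ∞ (fun x => (P x e * P x e - fderiv ℝ P x e e) / g x e e) U := by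
      have hPe : ContDiffOn ℝ ∞ (fun x => P x e) U := hg.smooth_form.clm_apply contDiffOn_const
      refine ContDiffOn.div ((hPe.mul hPe).sub ?_) (hg.smooth e e)
        fun x hx => (hg.pos x hx e he).ne'
      exact ((hg.smooth_form.fderiv_of_isOpen hU (m := ∞) (by norm_cast)).clm_apply
        contDiffOn_const).clm_apply contDiffOn_const
    refine h1.congr fun x hx => ?_
    have := (hg.pos x hx e he).ne'
    rw [hμ x hx]
    field_simp
    ring
  have hμd : ∀ x ∈ U, HasFDerivAt μ (fderiv ℝ μ x) x := fun x hx =>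
    ((hμsmooth.contDiffAt (hU.mem_nhds hx)).differentiableAt (by simp)).hasFDerivAt
  have hμ0 : ∀ x ∈ U, fderiv ℝ μ x = 0 := by
    intro x hx
    -- Commuting second derivatives of P(w). All terms cancel except those containing dμ.
    have hcomm : ∀ y z w, fderiv ℝ μ x y * g x z w = fderiv ℝ μ x z * g x y w := by
      intro y z w
      have h := fderiv_comm_of_fderiv_eq hU (f := fun y => P y w)
        (hg.smooth_form.clm_apply contDiffOn_const)
        (D := fun z y => P y z * P y w - μ y * g y z w)
        (fun y hy z => by rw [(hg.hasFDerivAt_form hU hy w).fderiv, ← hμ y hy]; rfl) hx z y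
      have hd : ∀ z, HasFDerivAt (fun y => P y z * P y w - μ y * g y z w) _ x := fun z =>
        ((hg.hasFDerivAt_form hU hx z).mul (hg.hasFDerivAt_form hU hx w)).sub
          ((hμd x hx).mul (hg.hasFDerivAt hU hx z w))
      rw [(hd y).fderiv, (hd z).fderiv] at h
      simp only [add_apply, smul_apply,
        sub_apply, ContinuousLinearMap.flip_apply, smul_eq_mul,
        hg.fderiv_eq x hx, hμ x hx] at h
      rw [hg.symm x hx y z] at h
      linear_combination h
    ext y
    -- Dimension at least 2 enters here: with z ⟂ y and w = z, `hcomm` reads dμ(y) g(z, z) = 0.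
    obtain ⟨z, hz0, hz⟩ : ∃ z, z ≠ 0 ∧ g x y z = 0 := by
      let ℓ : E →ₗ[ℝ] ℝ :=
        { toFun := g x y
          map_add' := fun u v => hg.add_right hx y u v
          map_smul' := fun a u => by simpa using hg.smul_right hx a y u }
      have hker : LinearMap.ker ℓ ≠ ⊥ := LinearMap.ker_ne_bot_of_finrank_lt (by simpa using hdim)
      obtain ⟨z, hz, hz0⟩ := Submodule.exists_mem_ne_zero_of_ne_bot hker
      exact ⟨z, hz0, hz⟩
    have := hcomm y z z
    rw [hz, mul_zero] at this
    simpa using (mul_eq_zero.1 this).resolve_right (hg.pos x hx z hz0).ne'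
  rcases U.eq_empty_or_nonempty with rfl | ⟨x₀, hx₀⟩
  · exact ⟨0, by simp⟩
  refine ⟨μ x₀, fun x hx z w => ?_⟩
  have hconst : μ x = μ x₀ := hU.is_const_of_fderiv_eq_zero hconn
    (fun y hy => (hμd y hy).differentiableAt.differentiableWithinAt) (fun y hy => hμ0 y hy) hx hx₀
  rw [← hconst, hμ x hx]

end IsProjectivelyFlatOn
end ProjectivelyFlat

/-! ### Integration of the scale and the metric along rays -/

section Rays

variable {E : Type*} [NormedAddCommGroup E] [NormedSpace ℝ E]

theorem HasFDerivAt.hasDerivAt_ray {F : Type*} [NormedAddCommGroup F] [NormedSpace ℝ F]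
    {f : E → F} {f' : E →L[ℝ] F} {x v : E} {t : ℝ} (h : HasFDerivAt f f' (x + t • v)) :
    HasDerivAt (fun t : ℝ => f (x + t • v)) (f' v) t := by
  have h1 : HasDerivAt (fun t : ℝ => x + t • v) v t := by
    simpa using ((hasDerivAt_id t).smul_const v).const_add x
  exact h.comp_hasDerivAt t h1

theorem eq_of_hasDerivAt_zero {f : ℝ → ℝ} (h : ∀ t ∈ Icc (0 : ℝ) 1, HasDerivAt f 0 t) {t : ℝ}
    (ht : t ∈ Icc (0 : ℝ) 1) : f t = f 0 :=
  constant_of_has_deriv_right_zero (fun t ht => (h t ht).continuousAt.continuousWithinAt)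
    (fun t ht => (h t (Ico_subset_Icc_self ht)).hasDerivWithinAt) t ht

namespace IsProjectivelyFlatOn

variable {g : E → E → E → ℝ} {P : E → E →L[ℝ] ℝ} {B : Set E} {x₀ : E} {μ : ℝ}

/-- The form `P` of a projectively flat metric of constant curvature is exact; `s` is the
exponential of a primitive. -/
theorem exists_scale (hg : IsProjectivelyFlatOn g P B) (hB : IsOpen B) (hconv : Convex ℝ B)
    (hμ : ∀ x ∈ B, ∀ z w, fderiv ℝ P x z w = P x z * P x w - μ * g x z w) (x₀ : E) :
    ∃ s : E → ℝ, s x₀ = 1 ∧ (∀ x, 0 < s x) ∧ ContDiffOn ℝ ∞ s B ∧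
      ∀ x ∈ B, HasFDerivAt s (-s x • P x) x := by
  -- The right side of the curvature equation is symmetric in z and w, so P is closed and has a
  -- primitive on the convex set B.
  obtain ⟨ψ, hψ⟩ := hconv.exists_forall_hasFDerivAt_of_fderiv_symmetric hB
    (hg.smooth_form.differentiableOn (by simp)) (fun x hx z w => by
      rw [hμ x hx, hμ x hx, hg.symm x hx]; ring)
  have hψs : ContDiffOn ℝ ∞ ψ B := by
    rw [contDiffOn_infty_iff_fderiv_of_isOpen hB]
    exact ⟨fun x hx => (hψ x hx).differentiableAt.differentiableWithinAt,
      hg.smooth_form.congr fun x hx => (hψ x hx).fderiv⟩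
  refine ⟨fun x => Real.exp (ψ x₀ - ψ x), by simp, fun x => Real.exp_pos _,
    Real.contDiff_exp.comp_contDiffOn (contDiffOn_const.sub hψs), fun x hx => ?_⟩
  refine (((hψ x hx).const_sub (ψ x₀)).exp).congr_fderiv ?_
  ext v; simp

theorem hasDerivAt_metric_ray (hg : IsProjectivelyFlatOn g P B) (hB : IsOpen B) {v : E} {t : ℝ}
    (h : x₀ + t • v ∈ B) (y z : E) :
    HasDerivAt (fun t : ℝ => g (x₀ + t • v) y z)
      (2 * P (x₀ + t • v) v * g (x₀ + t • v) y z + P (x₀ + t • v) y * g (x₀ + t • v) v z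
        + P (x₀ + t • v) z * g (x₀ + t • v) v y) t := by
  have := (hg.hasFDerivAt hB h y z).hasDerivAt_ray
  rwa [hg.fderiv_eq _ h] at this

theorem hasDerivAt_scale_ray {s : E → ℝ} (hs : ∀ x ∈ B, HasFDerivAt s (-s x • P x) x)
    {v : E} {t : ℝ} (h : x₀ + t • v ∈ B) :
    HasDerivAt (fun t : ℝ => s (x₀ + t • v)) (-s (x₀ + t • v) * P (x₀ + t • v) v) t := by
  simpa using (hs _ h).hasDerivAt_ray

/-- The square of the scale is an explicit quadratic polynomial. -/
theorem scale_sq_eq (hg : IsProjectivelyFlatOn g P B) (hB : IsOpen B) (hconv : Convex ℝ B)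
    (hμ : ∀ x ∈ B, ∀ z w, fderiv ℝ P x z w = P x z * P x w - μ * g x z w) (hx₀ : x₀ ∈ B)
    {s : E → ℝ} (hs0 : s x₀ = 1) (hs : ∀ x ∈ B, HasFDerivAt s (-s x • P x) x)
    {v : E} (hv : x₀ + v ∈ B) :
    s (x₀ + v) ^ 2 = (1 - P x₀ v) ^ 2 + μ * g x₀ v v := by
  have hray : ∀ t ∈ Icc (0 : ℝ) 1, x₀ + t • v ∈ B := fun t ht =>
    hconv.add_smul_mem hx₀ hv ht
  have hdp : ∀ t ∈ Icc (0 : ℝ) 1, HasDerivAt (fun t : ℝ => P (x₀ + t • v) v)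
      (P (x₀ + t • v) v ^ 2 - μ * g (x₀ + t • v) v v) t := fun t ht => by
    have := (hg.hasFDerivAt_form hB (hray t ht) v).hasDerivAt_ray
    rw [ContinuousLinearMap.flip_apply, hμ _ (hray t ht)] at this
    rwa [sq]
  -- With q(t) = s² along the ray, q' = -2Pq and q'' = 2(P² + μg)q, with P and g evaluated on v.
  -- Thus `f` is q + (1-t)q' + (1-t)²q''/2, the second-order Taylor polynomial based at t and
  -- evaluated at 1. It is constant because q''' = 0.
  let f : ℝ → ℝ := fun t =>
    s (x₀ + t • v) ^ 2 * (1 - 2 * (1 - t) * P (x₀ + t • v) v +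
      (1 - t) ^ 2 * (P (x₀ + t • v) v ^ 2 + μ * g (x₀ + t • v) v v))
  have hf : ∀ t ∈ Icc (0 : ℝ) 1, HasDerivAt f 0 t := by
    intro t ht
    have h0 : HasDerivAt (fun t : ℝ => 1 - t) (-1) t := (hasDerivAt_id t).const_sub 1
    have h1 := hasDerivAt_scale_ray hs (hray t ht)
    have h2 := hdp t ht
    have h3 := hg.hasDerivAt_metric_ray hB (hray t ht) v v
    refine ((h1.fun_pow 2).fun_mul ((((h0.const_mul 2).fun_mul h2).const_sub 1).fun_add
      ((h0.fun_pow 2).fun_mul ((h2.fun_pow 2).fun_add (h3.const_mul μ))))).congr_deriv ?_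
    simp
    ring
  have h1 := eq_of_hasDerivAt_zero hf (t := 1) (by simp)
  simp only [f, one_smul, zero_smul, add_zero, hs0] at h1
  linear_combination h1

/-- The scale determines the projective form. -/
theorem scale_sq_mul_form_eq (hg : IsProjectivelyFlatOn g P B) (hB : IsOpen B)
    (hconv : Convex ℝ B)
    (hμ : ∀ x ∈ B, ∀ z w, fderiv ℝ P x z w = P x z * P x w - μ * g x z w) (hx₀ : x₀ ∈ B)
    {s : E → ℝ} (hs0 : s x₀ = 1) (hs : ∀ x ∈ B, HasFDerivAt s (-s x • P x) x)
    {v : E} (hv : x₀ + v ∈ B) (y : E) :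
    s (x₀ + v) ^ 2 * P (x₀ + v) y = (1 - P x₀ v) * P x₀ y - μ * g x₀ v y := by
  have hs' : HasFDerivAt s (-s (x₀ + v) • P (x₀ + v)) (x₀ + v + (0 : ℝ) • y) := by
    simpa using hs _ hv
  -- The formula for s² is differentiated in direction y and compared with d(s²) = -2 s² P.
  have h1 : HasDerivAt (fun t : ℝ => s (x₀ + v + t • y) ^ 2)
      (-2 * s (x₀ + v) ^ 2 * P (x₀ + v) y) 0 := by
    refine (hs'.hasDerivAt_ray.fun_pow 2).congr_deriv ?_
    simp
    ring
  have h2 : HasDerivAt (fun t : ℝ => (1 - (P x₀ v + t * P x₀ y)) ^ 2 +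
      μ * (g x₀ v v + 2 * t * g x₀ v y + t ^ 2 * g x₀ y y))
      (-2 * (1 - P x₀ v) * P x₀ y + 2 * μ * g x₀ v y) 0 := by
    have hi := hasDerivAt_id (0 : ℝ)
    refine ((((hi.mul_const (P x₀ y)).const_add (P x₀ v)).const_sub 1).fun_pow 2 |>.fun_add
      (((((hi.const_mul 2).mul_const (g x₀ v y)).const_add (g x₀ v v)).fun_add
        ((hi.fun_pow 2).mul_const (g x₀ y y))).const_mul μ)).congr_deriv ?_
    simp
    ring
  have hcont : ContinuousAt (fun t : ℝ => x₀ + v + t • y) 0 := by fun_prop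
  have h3 : HasDerivAt (fun t : ℝ => s (x₀ + v + t • y) ^ 2)
      (-2 * (1 - P x₀ v) * P x₀ y + 2 * μ * g x₀ v y) 0 := by
    refine h2.congr_of_eventuallyEq ?_
    filter_upwards [hcont.eventually_mem (hB.mem_nhds (by simpa using hv))] with t ht
    rw [add_assoc] at ht ⊢
    rw [hg.scale_sq_eq hB hconv hμ hx₀ hs0 hs ht]
    simp only [map_add, map_smul, smul_eq_mul, hg.add_left _ hx₀, hg.add_right hx₀,
      hg.smul_left _ hx₀, hg.smul_right hx₀, hg.symm _ hx₀ y v]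
    ring
  have := h1.unique h3
  linarith

/-- The metric in projective coordinates is determined by its value and the value of `P` at a
point. -/
theorem scale_pow_four_mul_metric_eq (hg : IsProjectivelyFlatOn g P B) (hB : IsOpen B)
    (hconv : Convex ℝ B)
    (hμ : ∀ x ∈ B, ∀ z w, fderiv ℝ P x z w = P x z * P x w - μ * g x z w) (hx₀ : x₀ ∈ B)
    {s : E → ℝ} (hs0 : s x₀ = 1) (hspos : ∀ x, 0 < s x)
    (hs : ∀ x ∈ B, HasFDerivAt s (-s x • P x) x)
    {v : E} (hv : x₀ + v ∈ B) (y z : E) :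
    s (x₀ + v) ^ 4 * g (x₀ + v) y z =
      (1 - P x₀ v) ^ 2 * g x₀ y z + (1 - P x₀ v) * (P x₀ z * g x₀ v y + P x₀ y * g x₀ v z) +
      P x₀ y * P x₀ z * g x₀ v v + μ * (g x₀ v v * g x₀ y z - g x₀ v y * g x₀ v z) := by
  have hray : ∀ t ∈ Icc (0 : ℝ) 1, x₀ + t • v ∈ B := fun t ht =>
    hconv.add_smul_mem hx₀ hv ht
  -- The claimed value with v replaced by t v. It satisfies the same linear system along the ray as
  -- s⁴ g.
  let K : E → E → ℝ → ℝ := fun y z t =>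
    (1 - t * P x₀ v) ^ 2 * g x₀ y z +
      t * (1 - t * P x₀ v) * (P x₀ z * g x₀ v y + P x₀ y * g x₀ v z) +
      t ^ 2 * (P x₀ y * P x₀ z * g x₀ v v + μ * (g x₀ v v * g x₀ y z - g x₀ v y * g x₀ v z))
  have hform : ∀ t ∈ Icc (0 : ℝ) 1, ∀ y, s (x₀ + t • v) ^ 2 * P (x₀ + t • v) y =
      (1 - t * P x₀ v) * P x₀ y - μ * t * g x₀ v y := by
    intro t ht y
    rw [hg.scale_sq_mul_form_eq hB hconv hμ hx₀ hs0 hs (hray t ht), hg.smul_left _ hx₀]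
    simp
    ring
  have hscale : ∀ t ∈ Icc (0 : ℝ) 1, s (x₀ + t • v) ^ 2 =
      (1 - t * P x₀ v) ^ 2 + μ * t ^ 2 * g x₀ v v := by
    intro t ht
    rw [hg.scale_sq_eq hB hconv hμ hx₀ hs0 hs (hray t ht), hg.smul_left _ hx₀, hg.smul_right hx₀]
    simp
    ring
  have hK : ∀ t ∈ Icc (0 : ℝ) 1, ∀ y z, HasDerivAt (K y z)
      (-2 * P (x₀ + t • v) v * K y z t + P (x₀ + t • v) y * K v z t
        + P (x₀ + t • v) z * K v y t) t := by
    intro t ht y z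
    have hi := hasDerivAt_id t
    have h0 : HasDerivAt (fun t : ℝ => 1 - t * P x₀ v) (-P x₀ v) t := by
      simpa using (hi.mul_const (P x₀ v)).const_sub 1
    refine ((((h0.fun_pow 2).mul_const (g x₀ y z)).fun_add
      ((hi.fun_mul h0).mul_const (P x₀ z * g x₀ v y + P x₀ y * g x₀ v z))).fun_add
      ((hi.fun_pow 2).mul_const _)).congr_deriv ?_
    have hspos' : s (x₀ + t • v) ^ 2 ≠ 0 := (pow_pos (hspos _) 2).ne'
    apply mul_left_cancel₀ hspos'
    have e1 : s (x₀ + t • v) ^ 2 * (-2 * P (x₀ + t • v) v * K y z t + P (x₀ + t • v) y * K v z t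
        + P (x₀ + t • v) z * K v y t) =
        -2 * (s (x₀ + t • v) ^ 2 * P (x₀ + t • v) v) * K y z t +
        (s (x₀ + t • v) ^ 2 * P (x₀ + t • v) y) * K v z t
        + (s (x₀ + t • v) ^ 2 * P (x₀ + t • v) z) * K v y t := by ring
    rw [e1, hform t ht, hform t ht, hform t ht, hscale t ht]
    simp [K]
    ring
  -- The error vanishes at t = 0 and satisfies a triangular linear system: `e v v` is constant, then
  -- `e v z / s` is, then `e y z / s²`. The powers of s act as integrating factors, so no general
  -- uniqueness theorem is needed.
  let e : E → E → ℝ → ℝ := fun y z t => s (x₀ + t • v) ^ 4 * g (x₀ + t • v) y z - K y z t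
  have he : ∀ t ∈ Icc (0 : ℝ) 1, ∀ y z, HasDerivAt (e y z)
      (-2 * P (x₀ + t • v) v * e y z t + P (x₀ + t • v) y * e v z t
        + P (x₀ + t • v) z * e v y t) t := by
    intro t ht y z
    refine (((hasDerivAt_scale_ray hs (hray t ht)).fun_pow 4).fun_mul
      (hg.hasDerivAt_metric_ray hB (hray t ht) y z) |>.fun_sub (hK t ht y z)).congr_deriv ?_
    simp [e]
    ring
  have he0 : ∀ y z, e y z 0 = 0 := fun y z => by simp [e, K, hs0]
  have hvv : ∀ t ∈ Icc (0 : ℝ) 1, e v v t = 0 := by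
    intro t ht
    rw [← he0 v v]
    exact eq_of_hasDerivAt_zero (fun t ht => (he t ht v v).congr_deriv (by ring)) ht
  have hvz : ∀ t ∈ Icc (0 : ℝ) 1, ∀ z, e v z t = 0 := by
    intro t ht z
    have h1 : ∀ t ∈ Icc (0 : ℝ) 1, HasDerivAt (fun t => e v z t / s (x₀ + t • v)) 0 t := by
      intro t ht
      refine ((he t ht v z).fun_div (hasDerivAt_scale_ray hs (hray t ht))
        (hspos _).ne').congr_deriv ?_
      rw [hvv t ht]
      ring
    have h2 := eq_of_hasDerivAt_zero h1 ht
    simp only [he0, zero_div] at h2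
    exact (div_eq_zero_iff.1 h2).resolve_right (hspos _).ne'
  have hyz : ∀ t ∈ Icc (0 : ℝ) 1, e y z t = 0 := by
    intro t ht
    have h1 : ∀ t ∈ Icc (0 : ℝ) 1, HasDerivAt (fun t => e y z t / s (x₀ + t • v) ^ 2) 0 t := by
      intro t ht
      refine ((he t ht y z).fun_div ((hasDerivAt_scale_ray hs (hray t ht)).fun_pow 2)
        (pow_pos (hspos _) 2).ne').congr_deriv ?_
      rw [hvz t ht, hvz t ht]
      simp
      left
      ring
    have h2 := eq_of_hasDerivAt_zero h1 ht
    simp only [he0, zero_div] at h2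
    exact (div_eq_zero_iff.1 h2).resolve_right (pow_pos (hspos _) 2).ne'
  have := hyz 1 (by simp)
  simp only [e, K, one_smul] at this
  linear_combination this

end IsProjectivelyFlatOn
end Rays

/-! ### Closed conformal fields are affine up to the scale -/

section ConformalFields

/-- A vector field whose derivative is everywhere a multiple of the identity is affine. -/
theorem exists_eq_smul_add_of_fderiv_eq_smul {E : Type*} [NormedAddCommGroup E]
    [InnerProductSpace ℝ E] [FiniteDimensional ℝ E] (hdim : 1 < Module.finrank ℝ E)
    {V : E → E} {F : E → ℝ} {B : Set E} (hB : IsOpen B) (hconn : IsPreconnected B)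
    (hV : ContDiffOn ℝ ∞ V B) (hF : ∀ x ∈ B, ∀ u, fderiv ℝ V x u = F x • u) {x₀ : E}
    (hx₀ : x₀ ∈ B) : ∃ lam : ℝ, ∀ x ∈ B, V x = lam • (x - x₀) + V x₀ := by
  have : Nontrivial E := Module.nontrivial_of_finrank_pos (R := ℝ) (by omega)
  obtain ⟨e, he⟩ := exists_ne (0 : E)
  have hee : inner ℝ e e ≠ 0 := by simpa using he
  have hFsmooth : ContDiffOn ℝ ∞ F B := by
    have h1 : ContDiffOn ℝ ∞ (fun x => inner ℝ (fderiv ℝ V x e) e / inner ℝ e e) B :=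
      (((hV.fderiv_of_isOpen hB (m := ∞) (by norm_cast)).clm_apply
        contDiffOn_const).inner ℝ contDiffOn_const).div_const _
    refine h1.congr fun x hx => ?_
    rw [hF x hx, real_inner_smul_left, mul_div_cancel_right₀ _ hee]
  have hFd : ∀ x ∈ B, HasFDerivAt F (fderiv ℝ F x) x := fun x hx =>
    ((hFsmooth.contDiffAt (hB.mem_nhds hx)).differentiableAt (by simp)).hasFDerivAt
  -- Symmetry of the second derivative of V reads dF(z) w = dF(w) z. Pairing with a nonzero w ⟂ z
  -- kills the right side.
  have hF0 : ∀ x ∈ B, fderiv ℝ F x = 0 := by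
    intro x hx
    ext z
    obtain ⟨w, hw0, hw⟩ : ∃ w : E, w ≠ 0 ∧ inner ℝ z w = 0 := by
      have hker : LinearMap.ker (innerₛₗ ℝ z) ≠ ⊥ :=
        LinearMap.ker_ne_bot_of_finrank_lt (by simpa using hdim)
      obtain ⟨w, hw, hw0⟩ := Submodule.exists_mem_ne_zero_of_ne_bot hker
      exact ⟨w, hw0, hw⟩
    have h := fderiv_comm_of_fderiv_eq hB hV (D := fun w y => F y • w) hF hx z w
    rw [((hFd x hx).smul_const w).fderiv, ((hFd x hx).smul_const z).fderiv] at h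
    simp only [ContinuousLinearMap.smulRight_apply] at h
    have h2 := congrArg (fun u => inner ℝ u w) h
    simp only [real_inner_smul_left, hw, mul_zero] at h2
    simpa [hw0] using h2
  refine ⟨F x₀, fun x hx => ?_⟩
  have hFconst : ∀ y ∈ B, F y = F x₀ := fun y hy => hB.is_const_of_fderiv_eq_zero hconn
    (fun y hy => (hFd y hy).differentiableAt.differentiableWithinAt) hF0 hy hx₀
  have hd : ∀ y ∈ B, HasFDerivAt (fun y => V y - F x₀ • (y - x₀)) (0 : E →L[ℝ] E) y := by
    intro y hy
    have h1 : HasFDerivAt V (fderiv ℝ V y) y :=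
      ((hV.contDiffAt (hB.mem_nhds hy)).differentiableAt (by simp)).hasFDerivAt
    refine (h1.sub (((hasFDerivAt_id y).sub_const x₀).const_smul (F x₀))).congr_fderiv ?_
    ext u
    simp [hF y hy, hFconst y hy]
  have := hB.is_const_of_fderiv_eq_zero hconn
    (fun y hy => (hd y hy).differentiableAt.differentiableWithinAt)
    (fun y hy => (hd y hy).fderiv) hx hx₀
  simp only [sub_self, smul_zero, sub_zero] at this
  rw [← this]
  abel

variable {n : ℕ} {g : Rn n → Rn n → Rn n → ℝ} {U : Set (Rn n)} {x : Rn n}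

/-- The product rule in the base point and the moving argument. Smoothness of g is assumed only for
constant arguments, so X is expanded in the standard basis. -/
theorem IsMetricOn.fderiv_apply_field (hg : IsMetricOn g U) (hU : IsOpen U) (hx : x ∈ U)
    {X : Rn n → Rn n} (hX : DifferentiableAt ℝ X x) (v u : Rn n) :
    fderiv ℝ (fun z => g z (X z) v) x u =
      fderiv ℝ (fun z => g z (X x) v) x u + g x (fderiv ℝ X x u) v := by
  have hexp : ∀ a : Rn n, a = ∑ i, a i • EuclideanSpace.single i (1 : ℝ) := by
    intro a
    ext j
    simp [Finset.sum_apply, Pi.single_apply]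
  have hlin : ∀ z ∈ U, ∀ a : Rn n, g z a v = ∑ i, a i * g z (EuclideanSpace.single i 1) v := by
    intro z hz a
    let ℓ : Rn n →ₗ[ℝ] ℝ :=
      { toFun := fun a => g z a v
        map_add' := fun a b => hg.add_left z hz a b v
        map_smul' := fun c a => by simpa using hg.smul_left z hz c a v }
    change ℓ a = ∑ i, a i * ℓ (EuclideanSpace.single i 1)
    conv_lhs => rw [hexp a]
    simp
  have hXi : ∀ i, HasFDerivAt (fun z => X z i) ((EuclideanSpace.proj i).comp (fderiv ℝ X x)) x :=
    fun i => (EuclideanSpace.proj (𝕜 := ℝ) i).hasFDerivAt.comp x hX.hasFDerivAt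
  have h1 : HasFDerivAt (fun z => ∑ i, X z i * g z (EuclideanSpace.single i 1) v) _ x :=
    HasFDerivAt.fun_sum fun i _ =>
      (hXi i).fun_mul (hg.hasFDerivAt hU hx (EuclideanSpace.single i 1) v)
  have h2 : HasFDerivAt (fun z => g z (X z) v) _ x := h1.congr_of_eventuallyEq (by
    filter_upwards [hU.mem_nhds hx] with z hz using hlin z hz (X z))
  have h3 : HasFDerivAt (fun z => ∑ i, X x i * g z (EuclideanSpace.single i 1) v) _ x :=
    HasFDerivAt.fun_sum fun i _ =>
      (hg.hasFDerivAt hU hx (EuclideanSpace.single i 1) v).const_mul (X x i)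
  have h4 : HasFDerivAt (fun z => g z (X x) v) _ x := h3.congr_of_eventuallyEq (by
    filter_upwards [hU.mem_nhds hx] with z hz using hlin z hz (X x))
  rw [h2.fderiv, h4.fderiv, hlin x hx (fderiv ℝ X x u)]
  simp [Finset.sum_add_distrib, mul_comm]

namespace IsProjectivelyFlatOn

variable {P : Rn n → Rn n →L[ℝ] ℝ} {X : Rn n → Rn n}

/-- A closed conformal field satisfies `∇X = τ id` in projective coordinates. -/
theorem exists_fderiv_field_eq (hg : IsProjectivelyFlatOn g P U) (hU : IsOpen U) (hx : x ∈ U)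
    (hX : DifferentiableAt ℝ X x) {σ : ℝ}
    (hconf : ∀ u v, lieDerivMetric g X x u v = 2 * σ * g x u v)
    (hclosed : ∀ u v, fderiv ℝ (fun z => g z (X z) v) x u = fderiv ℝ (fun z => g z (X z) u) x v) :
    ∃ τ : ℝ, ∀ u, fderiv ℝ X x u + P x u • X x = τ • u := by
  -- The conformal equation gives the symmetric part of ∇X and closedness removes the skew part, so
  -- ∇X = σ id. Since ∇_u X = ∂_u X + P(u) X + P(X) u, the last term moves into the factor.
  refine ⟨σ - P x (X x), fun u => ?_⟩
  rw [← sub_eq_zero]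
  refine hg.eq_zero_of_forall hx fun w => ?_
  have h1 := hconf u w
  have h2 := hclosed u w
  rw [hg.fderiv_apply_field hU hx hX, hg.fderiv_apply_field hU hx hX] at h2
  simp only [lieDerivMetric, hg.fderiv_eq x hx] at h1 h2
  rw [hg.sub_left hx, hg.add_left x hx, hg.smul_left x hx, hg.smul_left x hx]
  rw [hg.symm x hx u (fderiv ℝ X x w)] at h1
  rw [hg.symm x hx w (X x), hg.symm x hx u (X x), hg.symm x hx w u] at h2
  linarith

/-- Closed conformal fields are affine in projective coordinates, up to the scale. -/
theorem exists_field_eq (hn : 2 ≤ n) (hg : IsProjectivelyFlatOn g P U) (hU : IsOpen U)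
    (hconn : IsPreconnected U) {s : Rn n → ℝ} (hspos : ∀ x, 0 < s x)
    (hs_smooth : ContDiffOn ℝ ∞ s U) (hs : ∀ x ∈ U, HasFDerivAt s (-s x • P x) x)
    (hX : ContDiffOn ℝ ∞ X U) {σ : Rn n → ℝ}
    (hconf : ∀ x ∈ U, ∀ u v, lieDerivMetric g X x u v = 2 * σ x * g x u v)
    (hclosed : ∀ x ∈ U, ∀ u v,
      fderiv ℝ (fun z => g z (X z) v) x u = fderiv ℝ (fun z => g z (X z) u) x v)
    {x₀ : Rn n} (hx₀ : x₀ ∈ U) :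
    ∃ (lam : ℝ) (a : Rn n), ∀ x ∈ U, X x = s x • (lam • (x - x₀) + a) := by
  have hXd : ∀ x ∈ U, DifferentiableAt ℝ X x := fun x hx =>
    (hX.contDiffAt (hU.mem_nhds hx)).differentiableAt (by simp)
  have h : ∀ x, ∃ τ : ℝ, x ∈ U → ∀ u, fderiv ℝ X x u + P x u • X x = τ • u := by
    intro x
    by_cases hx : x ∈ U
    · obtain ⟨τ, hτ⟩ := hg.exists_fderiv_field_eq hU hx (hXd x hx) (hconf x hx) (hclosed x hx)
      exact ⟨τ, fun _ => hτ⟩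
    · exact ⟨0, fun h => absurd h hx⟩
  choose τ hτ using h
  -- Since d(1/s) = P/s, the derivative of X/s is (∂X + P ⊗ X)/s = (τ/s) id.
  obtain ⟨lam, hlam⟩ := exists_eq_smul_add_of_fderiv_eq_smul (by rwa [finrank_euclideanSpace_fin]) hU hconn
    (V := fun x => (s x)⁻¹ • X x) (F := fun x => (s x)⁻¹ * τ x)
    ((hs_smooth.inv fun x _ => (hspos x).ne').smul hX) (fun x hx u => by
      have h1 : HasFDerivAt (fun x => (s x)⁻¹) (((s x)⁻¹) • P x) x := by
        refine ((hasDerivAt_inv (hspos x).ne').comp_hasFDerivAt x (hs x hx)).congr_fderiv ?_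
        ext w
        have := (hspos x).ne'
        simp
        field_simp
      rw [(h1.fun_smul (hXd x hx).hasFDerivAt).fderiv, mul_smul, ← hτ x hx u]
      simp [smul_smul]) hx₀
  refine ⟨lam, (s x₀)⁻¹ • X x₀, fun x hx => ?_⟩
  rw [← hlam x hx, smul_inv_smul₀ (hspos x).ne']

end IsProjectivelyFlatOn
end ConformalFields

/-! ### Metrics, fields and forms in charts and under change of chart -/

section ChartDifferentiability

variable {n : ℕ} {M : Type*} [TopologicalSpace M] [ChartedSpace (Rn n) M]
  {φ : OpenPartialHomeomorph M (Rn n)}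

theorem mdifferentiableAt_chart (hφ : φ ∈ IsManifold.maximalAtlas 𝓘(ℝ, Rn n) ∞ M) {p : M}
    (hp : p ∈ φ.source) : MDifferentiableAt 𝓘(ℝ, Rn n) 𝓘(ℝ, Rn n) φ p :=
  (contMDiffAt_of_mem_maximalAtlas hφ hp).mdifferentiableAt (by simp)

theorem mdifferentiableAt_chart_symm (hφ : φ ∈ IsManifold.maximalAtlas 𝓘(ℝ, Rn n) ∞ M) {x : Rn n}
    (hx : x ∈ φ.target) : MDifferentiableAt 𝓘(ℝ, Rn n) 𝓘(ℝ, Rn n) φ.symm x :=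
  (contMDiffAt_symm_of_mem_maximalAtlas hφ hx).mdifferentiableAt (by simp)

theorem mfderiv_chart_mfderiv_symm (hφ : φ ∈ IsManifold.maximalAtlas 𝓘(ℝ, Rn n) ∞ M) {x : Rn n}
    (hx : x ∈ φ.target) (u : Rn n) :
    mfderiv 𝓘(ℝ, Rn n) 𝓘(ℝ, Rn n) φ (φ.symm x)
      (mfderiv 𝓘(ℝ, Rn n) 𝓘(ℝ, Rn n) φ.symm x u) = u := by
  have h1 := (mdifferentiableAt_chart hφ (φ.map_target hx)).hasMFDerivAt.comp x
    (mdifferentiableAt_chart_symm hφ hx).hasMFDerivAt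
  have h2 : HasMFDerivAt 𝓘(ℝ, Rn n) 𝓘(ℝ, Rn n) (φ ∘ φ.symm) x
      (ContinuousLinearMap.id ℝ (TangentSpace 𝓘(ℝ, Rn n) x)) := by
    refine (hasMFDerivAt_id x).congr_of_eventuallyEq ?_
    filter_upwards [φ.open_target.mem_nhds hx] with y hy using φ.right_inv hy
  exact congrArg (fun A : Rn n →L[ℝ] Rn n => A u) (hasMFDerivAt_unique h1 h2)

theorem mfderiv_symm_mfderiv_chart (hφ : φ ∈ IsManifold.maximalAtlas 𝓘(ℝ, Rn n) ∞ M) {p : M}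
    (hp : p ∈ φ.source) (u : TangentSpace 𝓘(ℝ, Rn n) p) :
    mfderiv 𝓘(ℝ, Rn n) 𝓘(ℝ, Rn n) φ.symm (φ p) (mfderiv 𝓘(ℝ, Rn n) 𝓘(ℝ, Rn n) φ p u) = u := by
  have h1 := (mdifferentiableAt_chart_symm hφ (φ.map_source hp)).hasMFDerivAt.comp p
    (mdifferentiableAt_chart hφ hp).hasMFDerivAt
  have h2 : HasMFDerivAt 𝓘(ℝ, Rn n) 𝓘(ℝ, Rn n) (φ.symm ∘ φ) p
      (ContinuousLinearMap.id ℝ (TangentSpace 𝓘(ℝ, Rn n) p)) := by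
    refine (hasMFDerivAt_id p).congr_of_eventuallyEq ?_
    filter_upwards [φ.open_source.mem_nhds hp] with y hy using φ.left_inv hy
  exact congrArg (fun A : Rn n →L[ℝ] Rn n => A u) (hasMFDerivAt_unique h1 h2)

theorem fieldInChart_trans (W : ∀ p : M, TangentSpace 𝓘(ℝ, Rn n) p)
    (hφ : φ ∈ IsManifold.maximalAtlas 𝓘(ℝ, Rn n) ∞ M) {θ : OpenPartialHomeomorph (Rn n) (Rn n)}
    {x : Rn n} (hx : θ.symm x ∈ φ.target) {A : Rn n →L[ℝ] Rn n}
    (hA : HasFDerivAt θ A (θ.symm x)) :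
    fieldInChart W (φ.trans θ) x = A (fieldInChart W φ (θ.symm x)) := by
  have hA' : HasFDerivAt θ A (φ (φ.symm (θ.symm x))) := by rwa [φ.right_inv hx]
  have h1 : HasMFDerivAt 𝓘(ℝ, Rn n) 𝓘(ℝ, Rn n) (φ.trans θ) (φ.symm (θ.symm x)) _ :=
    hA'.hasMFDerivAt.comp (φ.symm (θ.symm x))
      (mdifferentiableAt_chart hφ (φ.map_target hx)).hasMFDerivAt
  change mfderiv 𝓘(ℝ, Rn n) 𝓘(ℝ, Rn n) (φ.trans θ) (φ.symm (θ.symm x))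
    (W (φ.symm (θ.symm x))) = _
  rw [h1.mfderiv]
  rfl

end ChartDifferentiability

section Charts

variable {n : ℕ} {M : Type*} [TopologicalSpace M] [ChartedSpace (Rn n) M]
  [IsManifold 𝓘(ℝ, Rn n) ∞ M] {φ : OpenPartialHomeomorph M (Rn n)}

theorem contMDiffOn_coordinateField (hφ : φ ∈ IsManifold.maximalAtlas 𝓘(ℝ, Rn n) ∞ M)
    (u : Rn n) :
    ContMDiffOn 𝓘(ℝ, Rn n) 𝓘(ℝ, Rn n).tangent ∞
      (fun x => (⟨φ.symm x, mfderiv 𝓘(ℝ, Rn n) 𝓘(ℝ, Rn n) φ.symm x u⟩ :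
        TangentBundle 𝓘(ℝ, Rn n) M)) φ.target := by
  have : IsManifold 𝓘(ℝ, Rn n) 1 M := IsManifold.of_le (n := ∞) (by norm_cast)
  have h1 := (contMDiffOn_symm_of_mem_maximalAtlas hφ).contMDiffOn_tangentMapWithin (m := ∞)
    (by norm_cast) φ.open_target.uniqueMDiffOn
  have h2 : ContMDiffOn 𝓘(ℝ, Rn n) 𝓘(ℝ, Rn n).tangent ∞
      (fun x => (⟨x, u⟩ : TangentBundle 𝓘(ℝ, Rn n) (Rn n))) φ.target :=
    contMDiffOn_vectorSpace_iff_contDiffOn.2 contDiffOn_const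
  refine (h1.comp h2 fun x hx => hx).congr fun x hx => ?_
  simp only [Function.comp_apply, tangentMapWithin]
  rw [mfderivWithin_of_isOpen φ.open_target hx]

theorem contDiffOn_metricInChart (h : SmoothRiemannianMetric n M)
    (hφ : φ ∈ IsManifold.maximalAtlas 𝓘(ℝ, Rn n) ∞ M) (u v : Rn n) :
    ContDiffOn ℝ ∞ (fun x => metricInChart h φ x u v) φ.target := by
  -- Makes `h` the inner product of the tangent spaces, so that smoothness of inner products of
  -- smooth sections applies.
  let : RiemannianBundle (fun p : M => TangentSpace 𝓘(ℝ, Rn n) p) := ⟨h.toRiemannianMetric⟩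
  rw [← contMDiffOn_iff_contDiffOn]
  exact ContMDiffOn.inner_bundle (contMDiffOn_coordinateField hφ u)
    (contMDiffOn_coordinateField hφ v)

theorem contDiffOn_fieldInChart {W : ∀ p : M, TangentSpace 𝓘(ℝ, Rn n) p}
    (hW : ContMDiff 𝓘(ℝ, Rn n) 𝓘(ℝ, Rn n).tangent ∞
      (fun p => (⟨p, W p⟩ : TangentBundle 𝓘(ℝ, Rn n) M)))
    (hφ : φ ∈ IsManifold.maximalAtlas 𝓘(ℝ, Rn n) ∞ M) :
    ContDiffOn ℝ ∞ (fieldInChart W φ) φ.target := by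
  have : IsManifold 𝓘(ℝ, Rn n) 1 M := IsManifold.of_le (n := ∞) (by norm_cast)
  have h1 := (contMDiffOn_of_mem_maximalAtlas hφ).contMDiffOn_tangentMapWithin (m := ∞)
    (by norm_cast) φ.open_source.uniqueMDiffOn
  have h2 := hW.comp_contMDiffOn (contMDiffOn_symm_of_mem_maximalAtlas hφ)
  have h3 : ContMDiffOn 𝓘(ℝ, Rn n) 𝓘(ℝ, Rn n).tangent ∞
      (fun x => (⟨x, fieldInChart W φ x⟩ : TangentBundle 𝓘(ℝ, Rn n) (Rn n))) φ.target := by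
    refine (h1.comp h2 fun x hx => φ.map_target hx).congr fun x hx => ?_
    simp only [Function.comp_apply, tangentMapWithin]
    rw [mfderivWithin_of_isOpen φ.open_source (φ.map_target hx), φ.right_inv hx]
    rfl
  exact contMDiffOn_vectorSpace_iff_contDiffOn.1 h3

theorem isMetricOn_metricInChart (h : SmoothRiemannianMetric n M)
    (hφ : φ ∈ IsManifold.maximalAtlas 𝓘(ℝ, Rn n) ∞ M) :
    IsMetricOn (metricInChart h φ) φ.target where
  smooth := contDiffOn_metricInChart h hφ
  add_left x _ u v w := by
    let A : Rn n →L[ℝ] Rn n := mfderiv 𝓘(ℝ, Rn n) 𝓘(ℝ, Rn n) φ.symm x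
    let G : Rn n →L[ℝ] Rn n →L[ℝ] ℝ := h.inner (φ.symm x)
    change G (A (u + v)) (A w) = G (A u) (A w) + G (A v) (A w)
    rw [map_add, map_add, add_apply]
  smul_left x _ a u w := by
    let A : Rn n →L[ℝ] Rn n := mfderiv 𝓘(ℝ, Rn n) 𝓘(ℝ, Rn n) φ.symm x
    let G : Rn n →L[ℝ] Rn n →L[ℝ] ℝ := h.inner (φ.symm x)
    change G (A (a • u)) (A w) = a * G (A u) (A w)
    rw [map_smul, map_smul, smul_apply, smul_eq_mul]
  symm x _ u v := h.symm _ _ _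
  pos x hx u hu := by
    refine h.pos _ _ fun h0 => hu ?_
    rw [← mfderiv_chart_mfderiv_symm hφ hx u, h0]
    exact map_zero _

theorem formInChart_flat (h : SmoothRiemannianMetric n M)
    (W : ∀ p : M, TangentSpace 𝓘(ℝ, Rn n) p)
    (hφ : φ ∈ IsManifold.maximalAtlas 𝓘(ℝ, Rn n) ∞ M) {x : Rn n} (hx : x ∈ φ.target) (y : Rn n) :
    formInChart (flat h W) φ x y = metricInChart h φ x (fieldInChart W φ x) y := by
  have h1 := mfderiv_symm_mfderiv_chart hφ (φ.map_target hx) (W (φ.symm x))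
  rw [φ.right_inv hx] at h1
  exact congrArg (fun a => h.inner (φ.symm x) a
    (mfderiv 𝓘(ℝ, Rn n) 𝓘(ℝ, Rn n) φ.symm x y)) h1.symm

theorem metricInChart_trans (h : SmoothRiemannianMetric n M)
    (hφ : φ ∈ IsManifold.maximalAtlas 𝓘(ℝ, Rn n) ∞ M) {θ : OpenPartialHomeomorph (Rn n) (Rn n)}
    {x : Rn n} (hx : θ.symm x ∈ φ.target) {A : Rn n →L[ℝ] Rn n} (hA : HasFDerivAt θ.symm A x)
    (u v : Rn n) :
    metricInChart h (φ.trans θ) x u v = metricInChart h φ (θ.symm x) (A u) (A v) := by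
  have h1 : HasMFDerivAt 𝓘(ℝ, Rn n) 𝓘(ℝ, Rn n) (φ.trans θ).symm x _ :=
    (mdifferentiableAt_chart_symm hφ hx).hasMFDerivAt.comp x hA.hasMFDerivAt
  unfold metricInChart
  rw [h1.mfderiv]
  rfl

theorem trans_mem_maximalAtlas (hφ : φ ∈ IsManifold.maximalAtlas 𝓘(ℝ, Rn n) ∞ M)
    {θ : OpenPartialHomeomorph (Rn n) (Rn n)} (hθ : ContDiffOn ℝ ∞ θ θ.source)
    (hθ' : ContDiffOn ℝ ∞ θ.symm θ.target) :
    φ.trans θ ∈ IsManifold.maximalAtlas 𝓘(ℝ, Rn n) ∞ M := by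
  apply OpenPartialHomeomorph.mem_maximalAtlas_of_contMDiffOn
  · exact (contMDiffOn_iff_contDiffOn.2 hθ).comp
      ((contMDiffOn_of_mem_maximalAtlas hφ).mono (by simp)) (by simp)
  · exact (contMDiffOn_symm_of_mem_maximalAtlas hφ).comp
      ((contMDiffOn_iff_contDiffOn.2 hθ').mono (by simp))
      (by rw [OpenPartialHomeomorph.trans_target]; exact inter_subset_right)

end Charts

/-! ### The normalizing projective change of coordinates -/

section ProjectiveMap

variable {n : ℕ}

/-- Every inner product on `ℝⁿ` is the pullback of the Euclidean one by a linear automorphism. -/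
theorem exists_linear_equiv_inner_eq {B : Rn n → Rn n → ℝ}
    (hadd : ∀ u v w, B (u + v) w = B u w + B v w) (hsmul : ∀ (a : ℝ) u w, B (a • u) w = a * B u w)
    (hsymm : ∀ u v, B u v = B v u) (hpos : ∀ u, u ≠ 0 → 0 < B u u) :
    ∃ L : Rn n ≃L[ℝ] Rn n, ∀ u w, inner ℝ (L u) (L w) = B u w := by
  obtain ⟨A, hA⟩ := exists_operator_of_bilinear hadd hsmul
    (fun u v w => by rw [hsymm, hadd, hsymm v, hsymm w])
    (fun a u w => by rw [hsymm, hsmul, hsymm w])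
  have hAsymm : (A : Rn n →ₗ[ℝ] Rn n).IsSymmetric := fun u w => by
    change inner ℝ (A u) w = inner ℝ u (A w)
    rw [hA, real_inner_comm, hA, hsymm]
  have hfr : Module.finrank ℝ (Rn n) = n := finrank_euclideanSpace_fin
  let e := hAsymm.eigenvectorBasis hfr
  let l := hAsymm.eigenvalues hfr
  have hl : ∀ i, 0 ≤ l i := by
    intro i
    have h1 : A (e i) = l i • e i := hAsymm.apply_eigenvectorBasis hfr i
    have h2 := hpos (e i) (e.orthonormal.ne_zero i)
    rw [← hA, h1, inner_smul_left, real_inner_self_eq_norm_sq, e.orthonormal.1 i] at h2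
    simpa using h2.le
  -- The square root of A, with its values read in coordinates with respect to the orthonormal
  -- eigenbasis.
  let L : Rn n →ₗ[ℝ] Rn n :=
    { toFun := fun u => WithLp.toLp 2 fun i => √(l i) * inner ℝ (e i) u
      map_add' := fun u v => by ext i; simp [inner_add_right, mul_add]
      map_smul' := fun a u => by ext i; simp [inner_smul_right]; ring }
  have hL : ∀ u w, inner ℝ (L u) (L w) = B u w := by
    intro u w
    have hexp : A u = ∑ i, (l i * inner ℝ (e i) u) • e i := by
      conv_lhs => rw [← e.sum_repr' u]
      rw [map_sum]
      refine Finset.sum_congr rfl fun i _ => ?_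
      have h1 : A (e i) = l i • e i := hAsymm.apply_eigenvectorBasis hfr i
      rw [map_smul, h1, smul_smul, mul_comm]
    rw [← hA, hexp, sum_inner, PiLp.inner_apply]
    refine Finset.sum_congr rfl fun i _ => ?_
    have := Real.mul_self_sqrt (hl i)
    simp only [L, LinearMap.coe_mk, AddHom.coe_mk, inner_smul_left]
    simp
    linear_combination (inner ℝ (e i) u * inner ℝ (e i) w) * this
  have hinj : Function.Injective L := by
    rw [injective_iff_map_eq_zero]
    intro u hu
    by_contra h0
    have := hpos u h0
    rw [← hL, hu, inner_zero_left] at this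
    exact lt_irrefl _ this
  exact ⟨(LinearEquiv.ofInjectiveEndo L hinj).toContinuousLinearEquiv, hL⟩

variable (L : Rn n ≃L[ℝ] Rn n) (b : Rn n →L[ℝ] ℝ) (x₀ : Rn n)

/-- The projective change of coordinates `x ↦ L (x - x₀) / (1 - b (x - x₀))`. -/
noncomputable def projectiveMap : OpenPartialHomeomorph (Rn n) (Rn n) where
  toFun x := (1 - b (x - x₀))⁻¹ • L (x - x₀)
  invFun X := x₀ + (1 + b (L.symm X))⁻¹ • L.symm X
  -- The positive side of the hyperplane, not just its complement: `1 + b (L.symm X)` is the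
  -- reciprocal of this quantity, and its sign later identifies √(1 + μ|X|²).
  source := {x | 0 < 1 - b (x - x₀)}
  target := {X | 0 < 1 + b (L.symm X)}
  map_source' x hx := by
    have hx' : 0 < 1 - b (x - x₀) := hx
    have : 1 + (1 - b (x - x₀))⁻¹ * b (x - x₀) = (1 - b (x - x₀))⁻¹ := by
      field_simp
      ring
    simp only [mem_ofPred_eq, map_smul, L.symm_apply_apply, smul_eq_mul, this]
    positivity
  map_target' X hX := by
    have hX' : 0 < 1 + b (L.symm X) := hX
    have : 1 - (1 + b (L.symm X))⁻¹ * b (L.symm X) = (1 + b (L.symm X))⁻¹ := by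
      field_simp
      ring
    simp only [mem_ofPred_eq, add_sub_cancel_left, map_smul, smul_eq_mul, this]
    positivity
  left_inv' x hx := by
    have hx' : 0 < 1 - b (x - x₀) := hx
    have : 1 + (1 - b (x - x₀))⁻¹ * b (x - x₀) = (1 - b (x - x₀))⁻¹ := by
      field_simp
      ring
    simp only [map_smul, L.symm_apply_apply, smul_eq_mul, this, inv_inv, smul_smul]
    rw [mul_inv_cancel₀ hx'.ne', one_smul, add_sub_cancel]
  right_inv' X hX := by
    have hX' : 0 < 1 + b (L.symm X) := hX
    have : 1 - (1 + b (L.symm X))⁻¹ * b (L.symm X) = (1 + b (L.symm X))⁻¹ := by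
      field_simp
      ring
    simp only [add_sub_cancel_left, map_smul, smul_eq_mul, this, inv_inv, smul_smul,
      L.apply_symm_apply]
    rw [mul_inv_cancel₀ hX'.ne', one_smul]
  open_source := isOpen_lt continuous_const (by fun_prop)
  open_target := isOpen_lt continuous_const (by fun_prop)
  continuousOn_toFun := by
    have h1 : Continuous fun x : Rn n => 1 - b (x - x₀) := by fun_prop
    have h2 : Continuous fun x : Rn n => L (x - x₀) := by fun_prop
    exact (h1.continuousOn.inv₀ fun x hx => ne_of_gt hx).smul h2.continuousOn
  continuousOn_invFun := by
    have h1 : Continuous fun X : Rn n => 1 + b (L.symm X) := by fun_prop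
    have h2 : Continuous fun X : Rn n => L.symm X := by fun_prop
    exact continuousOn_const.add
      ((h1.continuousOn.inv₀ fun x hx => ne_of_gt hx).smul h2.continuousOn)

theorem contDiffOn_projectiveMap :
    ContDiffOn ℝ ∞ (projectiveMap L b x₀) (projectiveMap L b x₀).source := by
  have h1 : ContDiff ℝ ∞ fun x : Rn n => 1 - b (x - x₀) :=
    contDiff_const.sub (b.contDiff.comp (contDiff_id.sub contDiff_const))
  exact (h1.contDiffOn.inv fun x hx => ne_of_gt hx).smul
    (L.contDiff.comp (contDiff_id.sub contDiff_const)).contDiffOn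

theorem contDiffOn_projectiveMap_symm :
    ContDiffOn ℝ ∞ (projectiveMap L b x₀).symm (projectiveMap L b x₀).target := by
  have h1 : ContDiff ℝ ∞ fun X : Rn n => 1 + b (L.symm X) :=
    contDiff_const.add (b.contDiff.comp L.symm.contDiff)
  exact contDiffOn_const.add ((h1.contDiffOn.inv fun x hx => ne_of_gt hx).smul
    L.symm.contDiff.contDiffOn)

/-- The derivative of `projectiveMap L b x₀` at the preimage of `X`. -/
noncomputable def projectiveMapDeriv (X : Rn n) : Rn n →L[ℝ] Rn n :=
  (1 + b (L.symm X)) • (L : Rn n →L[ℝ] Rn n) + ((1 + b (L.symm X)) • b).smulRight X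

/-- The derivative of the inverse of `projectiveMap L b x₀` at `X`. -/
noncomputable def projectiveMapSymmDeriv (X : Rn n) : Rn n →L[ℝ] Rn n :=
  (1 + b (L.symm X))⁻¹ • (L.symm : Rn n →L[ℝ] Rn n) -
    ((1 + b (L.symm X)) ^ 2)⁻¹ • (b.comp (L.symm : Rn n →L[ℝ] Rn n)).smulRight (L.symm X)

variable {L b x₀}

theorem one_sub_apply_projectiveMap_symm {X : Rn n} (hX : 0 < 1 + b (L.symm X)) :
    1 - b ((projectiveMap L b x₀).symm X - x₀) = (1 + b (L.symm X))⁻¹ := by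
  change 1 - b (x₀ + (1 + b (L.symm X))⁻¹ • L.symm X - x₀) = _
  rw [add_sub_cancel_left, map_smul, smul_eq_mul]
  field_simp
  ring

theorem hasFDerivAt_projectiveMap {X : Rn n} (hX : 0 < 1 + b (L.symm X)) :
    HasFDerivAt (projectiveMap L b x₀) (projectiveMapDeriv L b X)
      ((projectiveMap L b x₀).symm X) := by
  have h1 := one_sub_apply_projectiveMap_symm (x₀ := x₀) hX
  set x := (projectiveMap L b x₀).symm X with hx
  have hid : HasFDerivAt (fun y : Rn n => y - x₀) (ContinuousLinearMap.id ℝ (Rn n)) x :=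
    (hasFDerivAt_id x).sub_const x₀
  have hb : HasFDerivAt (fun y : Rn n => 1 - b (y - x₀)) (-b) x := by
    simpa using (b.hasFDerivAt.comp x hid).const_sub 1
  have hLd : HasFDerivAt (fun y : Rn n => L (y - x₀)) (L : Rn n →L[ℝ] Rn n) x :=
    L.hasFDerivAt.comp x hid
  have hinv := (hasDerivAt_inv (x := 1 - b (x - x₀)) (by rw [h1]; positivity)).comp_hasFDerivAt x hb
  refine (hinv.fun_smul hLd).congr_fderiv ?_
  have hLx : L (x - x₀) = (1 + b (L.symm X))⁻¹ • X := by
    rw [hx]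
    change L (x₀ + (1 + b (L.symm X))⁻¹ • L.symm X - x₀) = _
    rw [add_sub_cancel_left, map_smul, L.apply_symm_apply]
  ext1 w
  simp only [Function.comp_apply, hLx, h1, projectiveMapDeriv]
  simp only [neg_smul, inv_pow, inv_inv, smul_neg, neg_neg, add_apply, smul_apply,
    ContinuousLinearMap.smulRight_apply, smul_smul, smul_eq_mul, ContinuousLinearEquiv.coe_coe]
  congr 2
  field_simp

theorem hasFDerivAt_projectiveMap_symm {X : Rn n} (hX : 0 < 1 + b (L.symm X)) :
    HasFDerivAt (projectiveMap L b x₀).symm (projectiveMapSymmDeriv L b X) X := by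
  have hLd : HasFDerivAt (fun Y : Rn n => L.symm Y) (L.symm : Rn n →L[ℝ] Rn n) X :=
    L.symm.hasFDerivAt
  have hb : HasFDerivAt (fun Y : Rn n => 1 + b (L.symm Y))
      (b.comp (L.symm : Rn n →L[ℝ] Rn n)) X := (b.hasFDerivAt.comp X hLd).const_add 1
  have hinv := (hasDerivAt_inv hX.ne').comp_hasFDerivAt X hb
  refine ((hinv.fun_smul hLd).const_add x₀).congr_fderiv ?_
  ext1 w
  simp [projectiveMapSymmDeriv, smul_smul, sub_eq_add_neg]

end ProjectiveMap

/-! ### The metric and the field in normalized coordinates -/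

section KleinForm

variable {n : ℕ} {g : Rn n → Rn n → Rn n → ℝ} {P : Rn n → Rn n →L[ℝ] ℝ} {B : Set (Rn n)}
  {x₀ : Rn n} {μ : ℝ} {s : Rn n → ℝ} {L : Rn n ≃L[ℝ] Rn n}

namespace IsProjectivelyFlatOn

/-- The scale in the coordinates of `projectiveMap`. -/
theorem scale_sq_projectiveMap_symm (hg : IsProjectivelyFlatOn g P B) (hB : IsOpen B)
    (hconv : Convex ℝ B)
    (hμ : ∀ x ∈ B, ∀ z w, fderiv ℝ P x z w = P x z * P x w - μ * g x z w) (hx₀ : x₀ ∈ B)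
    (hs0 : s x₀ = 1) (hs : ∀ x ∈ B, HasFDerivAt s (-s x • P x) x)
    (hL : ∀ u w, inner ℝ (L u) (L w) = g x₀ u w) {X : Rn n} (hX : 0 < 1 + P x₀ (L.symm X))
    (hXB : (projectiveMap L (P x₀) x₀).symm X ∈ B) :
    (s ((projectiveMap L (P x₀) x₀).symm X) * (1 + P x₀ (L.symm X))) ^ 2 = 1 + μ * ‖X‖ ^ 2 := by
  have h1 := one_sub_apply_projectiveMap_symm (x₀ := x₀) hX
  have hx : (projectiveMap L (P x₀) x₀).symm X = x₀ + (1 + P x₀ (L.symm X))⁻¹ • L.symm X := rfl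
  rw [hx] at h1 hXB ⊢
  rw [add_sub_cancel_left] at h1
  -- With m = 1 + P(L⁻¹X), the displacement v = m⁻¹ L⁻¹X has 1 - P(v) = m⁻¹ and g(v, v) = m⁻²|X|².
  -- Hence s² = m⁻²(1 + μ|X|²), with no linear term left.
  rw [mul_pow, hg.scale_sq_eq hB hconv hμ hx₀ hs0 hs hXB, h1, ← hL, map_smul,
    L.apply_symm_apply, inner_smul_left, inner_smul_right, real_inner_self_eq_norm_sq]
  simp
  field_simp

/-- The metric takes the Klein form in the coordinates of `projectiveMap`. -/
theorem metric_projectiveMap_symm (hg : IsProjectivelyFlatOn g P B) (hB : IsOpen B)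
    (hconv : Convex ℝ B)
    (hμ : ∀ x ∈ B, ∀ z w, fderiv ℝ P x z w = P x z * P x w - μ * g x z w) (hx₀ : x₀ ∈ B)
    (hs0 : s x₀ = 1) (hspos : ∀ x, 0 < s x) (hs : ∀ x ∈ B, HasFDerivAt s (-s x • P x) x)
    (hL : ∀ u w, inner ℝ (L u) (L w) = g x₀ u w) {X : Rn n} (hX : 0 < 1 + P x₀ (L.symm X))
    (hXB : (projectiveMap L (P x₀) x₀).symm X ∈ B) (Y Z : Rn n) :
    g ((projectiveMap L (P x₀) x₀).symm X) (projectiveMapSymmDeriv L (P x₀) X Y)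
      (projectiveMapSymmDeriv L (P x₀) X Z) =
      ((1 + μ * ‖X‖ ^ 2) * inner ℝ Y Z - μ * inner ℝ X Y * inner ℝ X Z)
        / (1 + μ * ‖X‖ ^ 2) ^ 2 := by
  have hsq := hg.scale_sq_projectiveMap_symm hB hconv hμ hx₀ hs0 hs hL hX hXB
  have h1 := one_sub_apply_projectiveMap_symm (x₀ := x₀) hX
  have hx : (projectiveMap L (P x₀) x₀).symm X = x₀ + (1 + P x₀ (L.symm X))⁻¹ • L.symm X := rfl
  have hspos' := hspos ((projectiveMap L (P x₀) x₀).symm X)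
  rw [hx] at h1 hXB hsq hspos' ⊢
  rw [add_sub_cancel_left] at h1
  have hmain := hg.scale_pow_four_mul_metric_eq hB hconv hμ hx₀ hs0 hspos hs hXB
    (projectiveMapSymmDeriv L (P x₀) X Y) (projectiveMapSymmDeriv L (P x₀) X Z)
  rw [h1] at hmain
  have hLd : ∀ Y, L (projectiveMapSymmDeriv L (P x₀) X Y) = (1 + P x₀ (L.symm X))⁻¹ • Y -
      (((1 + P x₀ (L.symm X)) ^ 2)⁻¹ * P x₀ (L.symm Y)) • X := fun Y => by
    simp [projectiveMapSymmDeriv, smul_smul]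
  have hbd : ∀ Y, P x₀ (projectiveMapSymmDeriv L (P x₀) X Y) =
      ((1 + P x₀ (L.symm X)) ^ 2)⁻¹ * P x₀ (L.symm Y) := fun Y => by
    simp [projectiveMapSymmDeriv]
    field_simp
    ring
  simp only [← hL, hbd, hLd, map_smul, L.apply_symm_apply, inner_smul_left, inner_smul_right,
    inner_sub_left, inner_sub_right, RCLike.conj_to_real, real_inner_comm X Y,
    real_inner_self_eq_norm_sq] at hmain
  set m := 1 + P x₀ (L.symm X) with hm
  set S := s (x₀ + m⁻¹ • L.symm X)
  have hN : 1 + μ * ‖X‖ ^ 2 ≠ 0 := by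
    rw [← hsq]
    exact pow_ne_zero 2 (mul_pos hspos' hX).ne'
  rw [eq_div_iff (pow_ne_zero 2 hN)]
  -- This matches the denominator of the Klein form with the factor s⁴ in the ray formula.
  have hpow : (1 + μ * ‖X‖ ^ 2) ^ 2 = m ^ 4 * S ^ 4 := by rw [← hsq]; ring
  rw [hpow, mul_comm, mul_assoc, hmain]
  field_simp
  ring

/-- A field that is affine up to the scale keeps this form in the coordinates of
`projectiveMap`. -/
theorem field_projectiveMap_symm (hg : IsProjectivelyFlatOn g P B) (hB : IsOpen B)
    (hconv : Convex ℝ B)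
    (hμ : ∀ x ∈ B, ∀ z w, fderiv ℝ P x z w = P x z * P x w - μ * g x z w) (hx₀ : x₀ ∈ B)
    (hs0 : s x₀ = 1) (hspos : ∀ x, 0 < s x) (hs : ∀ x ∈ B, HasFDerivAt s (-s x • P x) x)
    (hL : ∀ u w, inner ℝ (L u) (L w) = g x₀ u w) {X : Rn n} (hX : 0 < 1 + P x₀ (L.symm X))
    (hXB : (projectiveMap L (P x₀) x₀).symm X ∈ B) {V : Rn n → Rn n} {lam : ℝ} {a : Rn n}
    (hV : ∀ x ∈ B, V x = s x • (lam • (x - x₀) + a)) :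
    projectiveMapDeriv L (P x₀) X (V ((projectiveMap L (P x₀) x₀).symm X)) =
      √(1 + μ * ‖X‖ ^ 2) • ((lam + P x₀ a) • X + L a) := by
  have hsq := hg.scale_sq_projectiveMap_symm hB hconv hμ hx₀ hs0 hs hL hX hXB
  have hspos' := hspos ((projectiveMap L (P x₀) x₀).symm X)
  -- Both s and 1 + P(L⁻¹X) are positive, so the square root is exactly their product.
  rw [← hsq, Real.sqrt_sq (mul_pos hspos' hX).le, hV _ hXB]
  have hx : (projectiveMap L (P x₀) x₀).symm X - x₀ = (1 + P x₀ (L.symm X))⁻¹ • L.symm X :=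
    add_sub_cancel_left _ _
  rw [hx]
  set m := 1 + P x₀ (L.symm X) with hm
  have hP : P x₀ (L.symm X) = m - 1 := by rw [hm]; ring
  set S := s ((projectiveMap L (P x₀) x₀).symm X)
  simp only [projectiveMapDeriv, map_smul, map_add, add_apply, smul_apply,
    ContinuousLinearMap.smulRight_apply, ContinuousLinearEquiv.coe_coe, L.apply_symm_apply, hP,
    smul_eq_mul]
  match_scalars <;> field_simp <;> ring

end IsProjectivelyFlatOn
end KleinForm

/-! ### Assembly of the local normal form -/

theorem lemma8p1 {n : ℕ} (hn : 2 ≤ n) {M : Type*} [TopologicalSpace M] [ChartedSpace (Rn n) M]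
    [IsManifold 𝓘(ℝ, Rn n) ∞ M] (h : SmoothRiemannianMetric n M)
    (W : ∀ p : M, TangentSpace 𝓘(ℝ, Rn n) p)
    (hW : ContMDiff 𝓘(ℝ, Rn n) 𝓘(ℝ, Rn n).tangent ∞
      (fun p => (⟨p, W p⟩ : TangentBundle 𝓘(ℝ, Rn n) M)))
    (hflat : IsLocallyProjectivelyFlat h) (hconf : IsConformalField h W)
    (hclosed : IsClosedForm (flat h W)) :
    ∀ p : M, ∃ φ ∈ IsManifold.maximalAtlas 𝓘(ℝ, Rn n) ∞ M, p ∈ φ.source ∧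
      ∃ (μ lam : ℝ) (a : Rn n), ∀ x ∈ φ.target,
        0 < 1 + μ * ‖x‖ ^ 2 ∧
        (∀ y : Rn n, √(metricInChart h φ x y y) =
          √((1 + μ * ‖x‖ ^ 2) * ‖y‖ ^ 2 - μ * inner ℝ x y ^ 2) / (1 + μ * ‖x‖ ^ 2)) ∧
        fieldInChart W φ x = √(1 + μ * ‖x‖ ^ 2) • (lam • x + a) ∧
        (∀ y : Rn n, formInChart (flat h W) φ x y =
          (lam * inner ℝ x y + (1 + μ * ‖x‖ ^ 2) * inner ℝ a y - μ * inner ℝ a x * inner ℝ x y)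
            / (1 + μ * ‖x‖ ^ 2) ^ (3 / 2 : ℝ)) := by
  intro p
  obtain ⟨φ, hφ, hp, hstraight⟩ := hflat p
  obtain ⟨σ, hσ⟩ := hconf
  set g := metricInChart h φ
  have hx₀φ := φ.map_source hp
  set x₀ := φ p with hx₀
  obtain ⟨P, hg⟩ := (isMetricOn_metricInChart h hφ).exists_isProjectivelyFlatOn φ.open_target
    hstraight
  -- A ball around x₀ on which the chart and the projective map are both defined. Its convexity
  -- permits integration along rays.
  have hopen : IsOpen (φ.target ∩ {x | 0 < 1 - P x₀ (x - x₀)}) :=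
    φ.open_target.inter (isOpen_lt continuous_const (by fun_prop))
  obtain ⟨r, hr, hball⟩ := Metric.isOpen_iff.1 hopen x₀ ⟨hx₀φ, by simp⟩
  set B := Metric.ball x₀ r
  have hB : IsOpen B := Metric.isOpen_ball
  have hconv : Convex ℝ B := convex_ball x₀ r
  have hx₀B : x₀ ∈ B := Metric.mem_ball_self hr
  have hBφ : B ⊆ φ.target := fun x hx => (hball hx).1
  replace hg := hg.mono hBφ
  obtain ⟨μ, hμ⟩ := hg.exists_curvature (by rwa [finrank_euclideanSpace_fin]) hB
    hconv.isPreconnected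
  obtain ⟨s, hs0, hspos, hs_smooth, hs⟩ := hg.exists_scale hB hconv hμ x₀
  obtain ⟨lam, a, hfield⟩ := hg.exists_field_eq hn hB hconv.isPreconnected hspos hs_smooth hs
    ((contDiffOn_fieldInChart hW hφ).mono hBφ) (σ := fun x => σ (φ.symm x))
    (fun x hx => hσ φ hφ x (hBφ hx))
    (fun x hx u v => by
      have hcl := hclosed φ hφ x (hBφ hx) u v
      have heq : ∀ w, fderiv ℝ (fun z => formInChart (flat h W) φ z w) x =
          fderiv ℝ (fun z => g z (fieldInChart W φ z) w) x := fun w => by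
        apply Filter.EventuallyEq.fderiv_eq
        filter_upwards [φ.open_target.mem_nhds (hBφ hx)] with z hz
          using formInChart_flat h W hφ hz w
      rwa [heq, heq] at hcl) hx₀B
  obtain ⟨L, hL⟩ := exists_linear_equiv_inner_eq (hg.add_left x₀ hx₀B) (hg.smul_left x₀ hx₀B)
    (hg.symm x₀ hx₀B) (hg.pos x₀ hx₀B)
  -- Restriction to B ensures that every point of the new chart's target comes from the ball where
  -- the ray formulas hold.
  let θ := (projectiveMap L (P x₀) x₀).restrOpen B hB
  have hΨ : φ.trans θ ∈ IsManifold.maximalAtlas 𝓘(ℝ, Rn n) ∞ M := trans_mem_maximalAtlas hφ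
    ((contDiffOn_projectiveMap L (P x₀) x₀).mono fun x hx => hx.1)
    ((contDiffOn_projectiveMap_symm L (P x₀) x₀).mono fun x hx => hx.1)
  -- The linear coefficient gains P(a) at x₀ from differentiating the denominator of the projective
  -- map.
  refine ⟨φ.trans θ, hΨ, ⟨hp, (hball hx₀B).2, hx₀B⟩, μ, lam + P x₀ a, L a, fun X hXΨ => ?_⟩
  have hX : 0 < 1 + P x₀ (L.symm X) := hXΨ.1.1
  have hXB : (projectiveMap L (P x₀) x₀).symm X ∈ B := hXΨ.1.2
  have hXφ : θ.symm X ∈ φ.target := hXΨ.2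
  have hN : 0 < 1 + μ * ‖X‖ ^ 2 := by
    rw [← hg.scale_sq_projectiveMap_symm hB hconv hμ hx₀B hs0 hs hL hX hXB]
    exact pow_pos (mul_pos (hspos _) hX) 2
  have hmetric : ∀ Y Z, metricInChart h (φ.trans θ) X Y Z =
      ((1 + μ * ‖X‖ ^ 2) * inner ℝ Y Z - μ * inner ℝ X Y * inner ℝ X Z)
        / (1 + μ * ‖X‖ ^ 2) ^ 2 := fun Y Z => by
    rw [metricInChart_trans h hφ hXφ (hasFDerivAt_projectiveMap_symm hX)]
    exact hg.metric_projectiveMap_symm hB hconv hμ hx₀B hs0 hspos hs hL hX hXB Y Z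
  have hW' : fieldInChart W (φ.trans θ) X =
      √(1 + μ * ‖X‖ ^ 2) • ((lam + P x₀ a) • X + L a) := by
    rw [fieldInChart_trans W hφ hXφ (hasFDerivAt_projectiveMap hX)]
    exact hg.field_projectiveMap_symm hB hconv hμ hx₀B hs0 hspos hs hL hX hXB hfield
  refine ⟨hN, fun y => ?_, hW', fun y => ?_⟩
  · rw [hmetric, Real.sqrt_div' _ (by positivity), Real.sqrt_sq hN.le, real_inner_self_eq_norm_sq]
    congr 2
    ring
  · rw [formInChart_flat h W hΨ hXΨ, hW', hmetric]
    have hpow : (1 + μ * ‖X‖ ^ 2) ^ (3 / 2 : ℝ) = (1 + μ * ‖X‖ ^ 2) * √(1 + μ * ‖X‖ ^ 2) := by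
      rw [Real.sqrt_eq_rpow, ← Real.rpow_one_add' hN.le (by norm_num)]
      norm_num
    have hsqrt := Real.mul_self_sqrt hN.le
    have hsqrt0 := Real.sqrt_pos.2 hN
    rw [hpow, div_eq_div_iff (by positivity) (by positivity)]
    simp only [inner_smul_left, inner_smul_right, inner_add_left, inner_add_right,
      RCLike.conj_to_real, real_inner_self_eq_norm_sq, real_inner_comm X (L a)]
    set N := 1 + μ * ‖X‖ ^ 2 with hNdef
    linear_combination (N * ((lam + P x₀ a) * inner ℝ X y + N * inner ℝ (L a) y
      - μ * inner ℝ X (L a) * inner ℝ X y)) * hsqrt
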